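/- Let $E$ be a countable set and let $R:E\times E\to\mathbb R$ satisfy $R(\eta,\xi)\ge 0$ for $\eta\ne\xi$, $-\infty<R(\eta,\eta)<0$ and $\sum_{\xi\in E}R(\eta,\xi)=0$ for every $\eta\in E$. Put $\lambda(\eta)=-R(\eta,\eta)$, $p(\eta,\xi)=R(\eta,\xi)/\lambda(\eta)$ for $\eta\neq\xi$, and $p(\eta,\eta)=0$. Let $(Y_n)_{n\ge0}$ be, under $\mathbf P_\eta$, the discrete-time Markov chain with transition probabilities $p$ started from $\eta$, assumed to be irreducible and recurrent, let $(e_n)_{n\ge 0}$ be i.i.d. mean one exponential random variables independent of $(Y_n)$, and let $\eta_t=Y_{\alpha(t)}$, where $\alpha(t)=\min\{n\ge0:\sum_{i=0}^n e_i/\lambda(Y_i)>t\}$; this is the continuous-time Markov chain with transition rates $R$. For $A\subseteq E$ let $$T_A=\inf\{t>0:\eta_t\in A\},\qquad T_A^+=\inf\{t>0:\eta_t\in A,\ \eta_s\ne\eta_0\text{ for some }0<s<t\},$$ and write $T_\xi=T_{\{\xi\}}$, $T^+_\xi=T^+_{\{\xi\}}$. Let $h:E\to[0,\infty)$ have nonempty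 support $F=\{\eta\in E:h(\eta)>0\}$, and let $\mathcal T^h_t=\int_0^t h(\eta_s)\,ds$, $\mathcal S^h_t=\sup\{s\ge0:\mathcal T^h_s\le t\}$ and $\eta^h_t=\eta_{\mathcal S^h_t}$ (the $h$-trace of $(\eta_t)$). Then, $\mathbf P_\eta$-almost surely for every $\eta\in F$, $\mathcal T^h_t<\infty$ for all $t$ and $\mathcal T^h_t\to\infty$ as $t\to\infty$, so that $\eta^h$ is well defined; and under $\{\mathbf P_\eta:\eta\in F\}$ the process $(\eta^h_t)_{t\ge0}$ is an irreducible, recurrent, strong Markov chain on $F$ (with right-continuous paths with left limits, with respect to its natural filtration) with transition rates $$R^h(\eta,\xi)=\frac{\lambda(\eta)}{h(\eta)}\,\mathbf P_\eta\big[T^+_F=T^+_\xi\big],\qquad \eta,\xi\in F,\ \eta\ne\xi,$$ and $R^h(\eta,\eta)=-\sum_{\xi\in F\setminus\{\eta\}}R^h(\eta,\xi)>-\infty$; that is, $\lim_{t\downarrow0}\big(\mathbf P_\eta[\eta^h_t=\xi]-\delta_{\eta,\xi}\big)/t=R^h(\eta,\xi)$ for all $\eta,\xi\in F$. Moreover,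 for every nonempty $F\subseteq E$, the transition rates $R^F$ of the $h$-trace with $h=\mathbf 1\{F\}$ satisfy, for all $\eta,\xi\in F$ with $\eta\ne\xi$, $$R^F(\eta,\xi)=R(\eta,\xi)+\sum_{\zeta\in E\setminus F}R(\eta,\zeta)\,\mathbf P_\zeta\big[T_F=T_\xi\big],$$ where the series converges. -/

import Mathlib

open MeasureTheory ProbabilityTheory Filter Topology Set
open scoped NNReal ENNReal

noncomputable section

namespace HTrace

variable {E Ω : Type*}

/-! ### Rates, jump chain and the continuous-time chain -/

/-- The rate matrices under consideration: nonnegative off the diagonal, (finite and) strictly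
negative on the diagonal, with rows summing to zero. -/
structure IsRateMatrix (R : E → E → ℝ) : Prop where
  nonneg : ∀ η ξ, η ≠ ξ → 0 ≤ R η ξ
  diag_neg : ∀ η, R η η < 0
  row_sum : ∀ η, HasSum (R η) 0

/-- The holding rate `λ(η) = -R(η,η)`. -/
def holdingRate (R : E → E → ℝ) (η : E) : ℝ := -R η η

open Classical in
/-- The jump probabilities `p(η,ξ) = R(η,ξ) / λ(η)` for `η ≠ ξ`, and `p(η,η) = 0`. -/
def jumpProb (R : E → E → ℝ) (η ξ : E) : ℝ :=
  if η = ξ then 0 else R η ξ / holdingRate R η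

open Classical in
/-- Under each `P η`, the sequence `Y` is a discrete-time Markov chain with transition
probabilities `p` started from `η`, and `e` is a sequence of i.i.d. mean one exponential random
variables, independent of `Y`. -/
structure IsJumpConstruction [MeasurableSpace E] [MeasurableSpace Ω] (p : E → E → ℝ)
    (P : E → Measure Ω) (Y : ℕ → Ω → E) (e : ℕ → Ω → ℝ) : Prop where
  measurable_chain : ∀ n, Measurable (Y n)
  measurable_exp : ∀ n, Measurable (e n)
  chain_law : ∀ (η : E) (n : ℕ) (x : ℕ → E),
    P η {ω | ∀ i ≤ n, Y i ω = x i} =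
      if x 0 = η then ∏ i ∈ Finset.range n, ENNReal.ofReal (p (x i) (x (i + 1))) else 0
  exp_law : ∀ η n, (P η).map (e n) = expMeasure 1
  exp_indep : ∀ η, iIndepFun e (P η)
  chain_indep_exp : ∀ η, IndepFun (fun ω n => Y n ω) (fun ω n => e n ω) (P η)

/-- The time change `α(t) = min {n ≥ 0 : ∑_{i ≤ n} e_i / λ(Y_i) > t}`. -/
def timeChange (R : E → E → ℝ) (Y : ℕ → Ω → E) (e : ℕ → Ω → ℝ) (t : ℝ≥0) (ω : Ω) : ℕ :=
  sInf {n : ℕ | (t : ℝ) < ∑ i ∈ Finset.range (n + 1), e i ω / holdingRate R (Y i ω)}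

/-- The continuous-time chain `η_t = Y_{α(t)}`. -/
def chain (R : E → E → ℝ) (Y : ℕ → Ω → E) (e : ℕ → Ω → ℝ) (t : ℝ≥0) (ω : Ω) : E :=
  Y (timeChange R Y e t ω) ω

/-! ### Hitting and return times of a path -/

/-- The hitting time `τ_A = inf {t > 0 : x_t ∈ A}`. -/
def hitTime (A : Set E) (x : ℝ≥0 → E) : ℝ≥0∞ :=
  sInf ((fun t : ℝ≥0 => (t : ℝ≥0∞)) '' {t | 0 < t ∧ x t ∈ A})

/-- The return time `τ⁺_A = inf {t > 0 : x_t ∈ A, x_s ≠ x_0 for some 0 < s < t}`. -/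
def returnTime (A : Set E) (x : ℝ≥0 → E) : ℝ≥0∞ :=
  sInf ((fun t : ℝ≥0 => (t : ℝ≥0∞)) ''
    {t | 0 < t ∧ x t ∈ A ∧ ∃ s, 0 < s ∧ s < t ∧ x s ≠ x 0})

/-! ### The `h`-trace -/

/-- The additive functional `𝒯^h_t = ∫_0^t h(η_s) ds`. -/
def additiveFunctional (h : E → ℝ≥0) (X : ℝ≥0 → Ω → E) (t : ℝ≥0) (ω : Ω) : ℝ≥0∞ :=
  ∫⁻ s in Icc (0 : ℝ) t, (h (X s.toNNReal ω) : ℝ≥0∞)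

/-- The generalized inverse `𝒮^h_t = sup {s ≥ 0 : 𝒯^h_s ≤ t}`. -/
def inverseFunctional (h : E → ℝ≥0) (X : ℝ≥0 → Ω → E) (t : ℝ≥0) (ω : Ω) : ℝ≥0 :=
  sSup {s : ℝ≥0 | additiveFunctional h X s ω ≤ t}

/-- The `h`-trace `η^h_t = η_{𝒮^h_t}`. -/
def hTrace (h : E → ℝ≥0) (X : ℝ≥0 → Ω → E) (t : ℝ≥0) (ω : Ω) : E :=
  X (inverseFunctional h X t ω) ω

/-! ### Irreducibility, recurrence, the strong Markov property, transition rates -/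

/-- The process `Z` (in discrete or continuous time) under the laws `P η`, `η ∈ F`, is
irreducible on `F`: every state of `F` leads to every state of `F`. -/
def IsIrreducibleOn {ι : Type*} [MeasurableSpace Ω] (F : Set E) (P : E → Measure Ω)
    (Z : ι → Ω → E) : Prop :=
  ∀ η ∈ F, ∀ ξ ∈ F, ∃ t, 0 < P η {ω | Z t ω = ξ}

/-- The process `Z` (in discrete or continuous time) under the laws `P η`, `η ∈ F`, is
recurrent: started from `η`, almost surely the set of times spent at `η` is unbounded. -/
def IsRecurrentOn {ι : Type*} [Preorder ι] [MeasurableSpace Ω] (F : Set E) (P : E → Measure Ω)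
    (Z : ι → Ω → E) : Prop :=
  ∀ η ∈ F, ∀ᵐ ω ∂(P η), ∃ᶠ t in atTop, Z t ω = η

/-- The natural filtration `ℱ_t = σ(Z_s : s ≤ t)`. -/
def naturalFiltration [MeasurableSpace E] [mΩ : MeasurableSpace Ω] (Z : ℝ≥0 → Ω → E)
    (hZ : ∀ t, Measurable (Z t)) : Filtration ℝ≥0 mΩ where
  seq t := ⨆ s ≤ t, MeasurableSpace.comap (Z s) inferInstance
  mono' _ _ hij := biSup_mono fun _ hs => hs.trans hij
  le' _ := iSup₂_le fun s _ => (hZ s).comap_le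

/-- Under `{P η : η ∈ F}`, `Z` is a strong Markov chain on `F`: started from `η`, almost surely
its paths stay in `F`, are right-continuous with left limits (for the discrete topology of `F`),
and, for every stopping time `τ` of the natural filtration, on `{τ < ∞}` and conditionally on
`ℱ_τ`, the process `(Z_{τ+t})_{t ≥ 0}` has the law of `Z` under `P (Z_τ)`. -/
structure IsStrongMarkovChainOn [MeasurableSpace E] [MeasurableSpace Ω] (F : Set E)
    (P : E → Measure Ω) (Z : ℝ≥0 → Ω → E) : Prop where
  measurable : ∀ t, Measurable (Z t)
  start : ∀ η ∈ F, ∀ᵐ ω ∂(P η), Z 0 ω = η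
  mem : ∀ η ∈ F, ∀ᵐ ω ∂(P η), ∀ t, Z t ω ∈ F
  right_continuous : ∀ η ∈ F, ∀ᵐ ω ∂(P η), ∀ t, ∀ᶠ s in 𝓝[>] t, Z s ω = Z t ω
  left_limits : ∀ η ∈ F, ∀ᵐ ω ∂(P η), ∀ t, ∃ x ∈ F, ∀ᶠ s in 𝓝[<] t, Z s ω = x
  strong_markov : ∀ η ∈ F, ∀ (τ : Ω → WithTop ℝ≥0)
    (hτ : IsStoppingTime (naturalFiltration Z measurable) τ) (A : Set Ω),
    MeasurableSet[hτ.measurableSpace] A → ∀ B : Set (ℝ≥0 → E), MeasurableSet B →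
      P η (A ∩ {ω | τ ω ≠ ⊤} ∩ {ω | (fun t => Z ((τ ω).untopD 0 + t) ω) ∈ B}) =
        ∫⁻ ω in A ∩ {ω | τ ω ≠ ⊤}, P (Z ((τ ω).untopD 0) ω) {ω' | (fun t => Z t ω') ∈ B} ∂(P η)

open Classical in
/-- `Q` is the matrix of transition rates on `F` of the process `Z`:
`lim_{t ↓ 0} (P_η[Z_t = ξ] - δ_{η,ξ}) / t = Q(η,ξ)` for all `η, ξ ∈ F`. -/
def HasTransitionRates [MeasurableSpace Ω] (F : Set E) (P : E → Measure Ω)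
    (Z : ℝ≥0 → Ω → E) (Q : E → E → ℝ) : Prop :=
  ∀ η ∈ F, ∀ ξ ∈ F,
    Tendsto (fun t : ℝ≥0 => ((P η).real {ω | Z t ω = ξ} - if η = ξ then 1 else 0) / (t : ℝ))
      (𝓝[>] 0) (𝓝 (Q η ξ))

/-- The off-diagonal rate `(λ(η) / h(η)) P_η[T⁺_F = T⁺_ξ]`, where `F` is the support of `h`. -/
def traceRate [MeasurableSpace Ω] (R : E → E → ℝ) (P : E → Measure Ω) (X : ℝ≥0 → Ω → E)
    (h : E → ℝ≥0) (η ξ : E) : ℝ :=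
  holdingRate R η / h η *
    (P η).real {ω | returnTime (Function.support h) (fun t => X t ω) =
      returnTime {ξ} (fun t => X t ω)}

open Classical in
/-- The full rate matrix on `F` (the support of `h`): `traceRate` off the diagonal, and rows
summing to zero. -/
def traceRateMatrix [MeasurableSpace Ω] (R : E → E → ℝ) (P : E → Measure Ω) (X : ℝ≥0 → Ω → E)
    (h : E → ℝ≥0) (η ξ : E) : ℝ :=
  if η = ξ then -∑' ζ : ↥(Function.support h \ {η}), traceRate R P X h η ζ
  else traceRate R P X h η ξ

end HTrace

end

noncomputable section

namespace HTrace

/-! ### Paths of the jump construction -/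

/-- A trajectory of the jump chain together with the sequence of exponential clocks. -/
abbrev JumpPath (E : Type*) := (ℕ → E) × (ℕ → ℝ)

variable {E : Type*}

/-- The time of the `n`-th jump when the state `x` is held for `g x` times its exponential
clock. -/
def clock (g : E → ℝ) (w : JumpPath E) (n : ℕ) : ℝ := ∑ i ∈ Finset.range n, w.2 i * g (w.1 i)

/-- The number of jumps up to time `t`. -/
def jumpIndex (g : E → ℝ) (t : ℝ≥0) (w : JumpPath E) : ℕ := sInf {n | (t : ℝ) < clock g w (n + 1)}

/-- The state at time `t`. -/
def pathAt (g : E → ℝ) (t : ℝ≥0) (w : JumpPath E) : E := w.1 (jumpIndex g t w)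

/-- Positive clocks and no explosion. -/
structure IsRegularPath (g : E → ℝ) (w : JumpPath E) : Prop where
  pos : ∀ i, 0 < w.2 i
  tendsto : Tendsto (clock g w) atTop atTop

/-- The trajectory with a first state and a first clock added. -/
def consPath (x : E) (a : ℝ) (w : JumpPath E) : JumpPath E :=
  (fun n => Nat.casesOn n x w.1, fun n => Nat.casesOn n a w.2)

/-- The trajectory after the first jump. -/
def tailPath (w : JumpPath E) : JumpPath E := (fun n => w.1 (n + 1), fun n => w.2 (n + 1))

lemma consPath_tailPath (w : JumpPath E) : consPath (w.1 0) (w.2 0) (tailPath w) = w := by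
  refine Prod.ext ?_ ?_ <;> funext n <;> cases n <;> rfl

@[simp] lemma clock_zero (g : E → ℝ) (w : JumpPath E) : clock g w 0 = 0 := by simp [clock]

lemma clock_succ (g : E → ℝ) (w : JumpPath E) (n : ℕ) :
    clock g w (n + 1) = clock g w n + w.2 n * g (w.1 n) := by
  simp [clock, Finset.sum_range_succ]

lemma clock_consPath_succ (g : E → ℝ) (x : E) (a : ℝ) (w : JumpPath E) (n : ℕ) :
    clock g (consPath x a w) (n + 1) = a * g x + clock g w n := by
  rw [clock, Finset.sum_range_succ', add_comm]
  rfl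

lemma clock_tailPath (g : E → ℝ) (w : JumpPath E) (n : ℕ) :
    clock g (tailPath w) n = clock g w (n + 1) - w.2 0 * g (w.1 0) := by
  conv_rhs => rw [← consPath_tailPath w, clock_consPath_succ]
  simp [consPath]

section Regular

variable {g : E → ℝ} {w : JumpPath E}

lemma IsRegularPath.tail (hw : IsRegularPath g w) : IsRegularPath g (tailPath w) := by
  refine ⟨fun i => hw.pos _, ?_⟩
  have : clock g (tailPath w) = fun n => clock g w (n + 1) + (- (w.2 0 * g (w.1 0))) := by
    funext n; rw [clock_tailPath]; ring
  rw [this]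
  exact tendsto_atTop_add_const_right _ _ ((tendsto_add_atTop_iff_nat 1).2 hw.tendsto)

lemma IsRegularPath.clock_mono (hg : ∀ x, 0 ≤ g x) (hw : IsRegularPath g w) :
    Monotone (clock g w) :=
  monotone_nat_of_le_succ fun n => by
    rw [clock_succ]
    linarith [mul_nonneg (hw.pos n).le (hg (w.1 n))]

lemma IsRegularPath.exists_lt_clock (hw : IsRegularPath g w) (t : ℝ) :
    ∃ n, t < clock g w (n + 1) :=
  (((tendsto_add_atTop_iff_nat 1).2 hw.tendsto).eventually_gt_atTop t).exists

lemma IsRegularPath.lt_clock_jumpIndex (hw : IsRegularPath g w) (t : ℝ≥0) :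
    (t : ℝ) < clock g w (jumpIndex g t w + 1) :=
  Nat.sInf_mem (s := {n | (t : ℝ) < clock g w (n + 1)}) (hw.exists_lt_clock t)

lemma clock_jumpIndex_le (t : ℝ≥0) : clock g w (jumpIndex g t w) ≤ t := by
  rcases h : jumpIndex g t w with _ | n
  · simp
  · by_contra! hlt
    have := Nat.sInf_le (s := {n | (t : ℝ) < clock g w (n + 1)}) hlt
    change jumpIndex g t w ≤ n at this
    omega

lemma IsRegularPath.pathAt_pos (hg : ∀ x, 0 ≤ g x) (hw : IsRegularPath g w) (t : ℝ≥0) :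
    0 < g (pathAt g t w) := by
  have h1 := hw.lt_clock_jumpIndex t
  have h2 := clock_jumpIndex_le (g := g) (w := w) t
  rw [clock_succ] at h1
  refine lt_of_le_of_ne (hg _) fun h0 => ?_
  rw [pathAt] at h0
  rw [← h0] at h1
  linarith

lemma IsRegularPath.jumpIndex_eq (hg : ∀ x, 0 ≤ g x) (hw : IsRegularPath g w) {t : ℝ≥0} {n : ℕ}
    (h1 : clock g w n ≤ t) (h2 : (t : ℝ) < clock g w (n + 1)) : jumpIndex g t w = n := by
  apply le_antisymm
  · exact Nat.sInf_le (s := {n | (t : ℝ) < clock g w (n + 1)}) h2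
  · by_contra! hlt
    have := hw.clock_mono hg (Nat.succ_le_of_lt hlt)
    have := hw.lt_clock_jumpIndex t
    simp only [Nat.succ_eq_add_one] at *
    linarith

lemma IsRegularPath.pathAt_eq (hg : ∀ x, 0 ≤ g x) (hw : IsRegularPath g w) {t : ℝ≥0} {n : ℕ}
    (h1 : clock g w n ≤ t) (h2 : (t : ℝ) < clock g w (n + 1)) : pathAt g t w = w.1 n := by
  rw [pathAt, hw.jumpIndex_eq hg h1 h2]

lemma pathAt_consPath_of_lt {x : E} {a : ℝ} {t : ℝ≥0} (h : (t : ℝ) < a * g x) :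
    pathAt g t (consPath x a w) = x := by
  have : jumpIndex g t (consPath x a w) = 0 := by
    refine Nat.sInf_eq_zero.2 (Or.inl ?_)
    simp [clock_consPath_succ, h]
  rw [pathAt, this]
  rfl

lemma IsRegularPath.jumpIndex_consPath (hw : IsRegularPath g w) {x : E} {a : ℝ}
    {b t : ℝ≥0} (hb : (b : ℝ) = a * g x) (h : b ≤ t) :
    jumpIndex g t (consPath x a w) = jumpIndex g (t - b) w + 1 := by
  have key : ∀ n, (t : ℝ) < clock g (consPath x a w) (n + 1) ↔
      ((t - b : ℝ≥0) : ℝ) < clock g w n := by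
    intro n
    rw [clock_consPath_succ, NNReal.coe_sub h, hb]
    constructor <;> intro <;> linarith
  have hS : ∃ n, (t : ℝ) < clock g (consPath x a w) (n + 1) := by
    obtain ⟨n, hn⟩ := hw.exists_lt_clock ((t - b : ℝ≥0) : ℝ)
    exact ⟨n + 1, (key _).2 hn⟩
  apply le_antisymm
  · exact Nat.sInf_le (s := {n | (t : ℝ) < clock g (consPath x a w) (n + 1)})
      ((key _).2 (hw.lt_clock_jumpIndex _))
  · have hm := Nat.sInf_mem (s := {n | (t : ℝ) < clock g (consPath x a w) (n + 1)}) hS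
    change (t : ℝ) < clock g (consPath x a w) (jumpIndex g t (consPath x a w) + 1) at hm
    rw [key] at hm
    rcases hj : jumpIndex g t (consPath x a w) with _ | n
    · rw [hj, clock_zero] at hm
      exact absurd hm (not_lt.2 (NNReal.coe_nonneg _))
    · rw [hj] at hm
      exact Nat.succ_le_succ
        (Nat.sInf_le (s := {n | ((t - b : ℝ≥0) : ℝ) < clock g w (n + 1)}) hm)

lemma IsRegularPath.pathAt_consPath (hw : IsRegularPath g w) {x : E} {a : ℝ}
    {b t : ℝ≥0} (hb : (b : ℝ) = a * g x) (h : b ≤ t) :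
    pathAt g t (consPath x a w) = pathAt g (t - b) w := by
  rw [pathAt, hw.jumpIndex_consPath hb h]
  rfl

lemma IsRegularPath.pathAt_right_continuous (hg : ∀ x, 0 ≤ g x) (hw : IsRegularPath g w)
    (t : ℝ≥0) : ∀ᶠ s in 𝓝[>] t, pathAt g s w = pathAt g t w := by
  have h1 : ∀ᶠ s : ℝ≥0 in 𝓝[>] t, (s : ℝ) < clock g w (jumpIndex g t w + 1) := by
    apply nhdsWithin_le_nhds
    exact (NNReal.continuous_coe.tendsto t).eventually_lt_const (hw.lt_clock_jumpIndex t)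
  filter_upwards [h1, self_mem_nhdsWithin] with s hs hts
  exact hw.pathAt_eq hg ((clock_jumpIndex_le t).trans (NNReal.coe_le_coe.2 (le_of_lt hts))) hs

lemma IsRegularPath.pathAt_left_limit (hg : ∀ x, 0 ≤ g x) (hw : IsRegularPath g w)
    (t : ℝ≥0) : ∃ x, 0 < g x ∧ ∀ᶠ s in 𝓝[<] t, pathAt g s w = x := by
  rcases eq_or_ne t 0 with rfl | ht
  · refine ⟨pathAt g 0 w, hw.pathAt_pos hg 0, ?_⟩
    simp
  · have hex : ∃ n, (t : ℝ) ≤ clock g w (n + 1) := (hw.exists_lt_clock t).imp fun _ => le_of_lt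
    set n := Nat.find hex with hn
    have h2 : (t : ℝ) ≤ clock g w (n + 1) := Nat.find_spec hex
    have h1 : clock g w n < t := by
      rcases hm : n with _ | m
      · simpa using pos_iff_ne_zero.2 ht
      · have := Nat.find_min hex (m := m) (by omega)
        exact not_le.1 this
    refine ⟨w.1 n, ?_, ?_⟩
    · refine lt_of_le_of_ne (hg _) fun h0 => ?_
      rw [clock_succ, ← h0] at h2
      linarith
    · have h3 : ∀ᶠ s : ℝ≥0 in 𝓝[<] t, clock g w n < s := by
        apply nhdsWithin_le_nhds
        exact (NNReal.continuous_coe.tendsto t).eventually_const_lt h1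
      filter_upwards [h3, self_mem_nhdsWithin] with s hs hst
      exact hw.pathAt_eq hg hs.le ((NNReal.coe_lt_coe.2 hst).trans_le h2)

/-- At time zero the process sits at the first state with a positive holding factor. -/
lemma pathAt_zero_eq (hw : ∀ i, 0 < w.2 i) {n : ℕ} (hn : 0 < g (w.1 n))
    (hlt : ∀ k < n, g (w.1 k) = 0) : pathAt g 0 w = w.1 n := by
  have h0 : ∀ m ≤ n, clock g w m = 0 := fun m hm => Finset.sum_eq_zero fun i hi => by
    rw [hlt i ((Finset.mem_range.1 hi).trans_le hm), mul_zero]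
  have : jumpIndex g 0 w = n := by
    apply le_antisymm
    · refine Nat.sInf_le (s := {n | ((0 : ℝ≥0) : ℝ) < clock g w (n + 1)}) ?_
      simp [clock_succ, h0 n le_rfl, mul_pos (hw n) hn]
    · refine le_csInf ⟨n, by simp [clock_succ, h0 n le_rfl, mul_pos (hw n) hn]⟩ fun m hm => ?_
      by_contra! hlt
      have := h0 (m + 1) hlt
      simp [this] at hm
  rw [pathAt, this]

end Regular

end HTrace

end

noncomputable section

namespace HTrace

variable {E : Type*}

/-! ### Hitting and return times of a regular path -/

section Hitting

variable {g : E → ℝ} {w : JumpPath E}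

lemma IsRegularPath.clock_strictMono (hg : ∀ x, 0 < g x) (hw : IsRegularPath g w) :
    StrictMono (clock g w) :=
  strictMono_nat_of_lt_succ fun n => by
    rw [clock_succ]
    linarith [mul_pos (hw.pos n) (hg (w.1 n))]

lemma IsRegularPath.clock_nonneg (hg : ∀ x, 0 ≤ g x) (hw : IsRegularPath g w) (n : ℕ) :
    0 ≤ clock g w n := by
  simpa using hw.clock_mono hg (Nat.zero_le n)

lemma IsRegularPath.clock_le_hitTime (hg : ∀ x, 0 < g x) (hw : IsRegularPath g w) {A : Set E}
    {n : ℕ} (hlt : ∀ k < n, w.1 k ∉ A) :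
    ENNReal.ofReal (clock g w n) ≤ hitTime A (fun t => pathAt g t w) := by
  refine le_sInf ?_
  rintro _ ⟨t, ⟨_, ht⟩, rfl⟩
  have hle : n ≤ jumpIndex g t w := by
    by_contra! h
    exact hlt _ h ht
  dsimp only
  rw [← ENNReal.ofReal_coe_nnreal]
  exact ENNReal.ofReal_le_ofReal
    ((hw.clock_mono (fun x => (hg x).le) hle).trans (clock_jumpIndex_le t))

lemma IsRegularPath.hitTime_eq (hg : ∀ x, 0 < g x) (hw : IsRegularPath g w) {A : Set E} {n : ℕ}
    (hn : w.1 n ∈ A) (hlt : ∀ k < n, w.1 k ∉ A) :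
    hitTime A (fun t => pathAt g t w) = ENNReal.ofReal (clock g w n) := by
  have hg' : ∀ x, 0 ≤ g x := fun x => (hg x).le
  apply le_antisymm
  · refine le_of_forall_gt fun c hc => ?_
    have hc' : ENNReal.ofReal (clock g w n) < min c (ENNReal.ofReal (clock g w (n + 1))) := by
      refine lt_min hc ?_
      rw [ENNReal.ofReal_lt_ofReal_iff_of_nonneg (hw.clock_nonneg hg' n)]
      exact hw.clock_strictMono hg (Nat.lt_succ_self n)
    obtain ⟨t, ht1, ht2⟩ := ENNReal.lt_iff_exists_nnreal_btwn.1 hc'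
    have h1 : clock g w n < t := by
      rw [← ENNReal.ofReal_coe_nnreal] at ht1
      exact (ENNReal.ofReal_lt_ofReal_iff_of_nonneg (hw.clock_nonneg hg' n)).1 ht1
    have h2 : (t : ℝ) < clock g w (n + 1) := by
      have := ht2.trans_le (min_le_right _ _)
      rw [← ENNReal.ofReal_coe_nnreal] at this
      exact (ENNReal.ofReal_lt_ofReal_iff_of_nonneg t.coe_nonneg).1 this
    refine lt_of_le_of_lt (sInf_le ⟨t, ⟨?_, ?_⟩, rfl⟩) (ht2.trans_le (min_le_left _ _))
    · exact NNReal.coe_pos.1 ((hw.clock_nonneg hg' n).trans_lt h1)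
    · change pathAt g t w ∈ A
      rwa [hw.pathAt_eq hg' h1.le h2]
  · exact hw.clock_le_hitTime hg hlt

/-- The path enters `A` at `y` exactly when the hitting times of `A` and of `y` coincide. -/
lemma IsRegularPath.hitTime_eq_hitTime_iff (hg : ∀ x, 0 < g x) (hw : IsRegularPath g w)
    {A : Set E} {n : ℕ} (hn : w.1 n ∈ A) (hlt : ∀ k < n, w.1 k ∉ A) {y : E} (hy : y ∈ A) :
    hitTime A (fun t => pathAt g t w) = hitTime {y} (fun t => pathAt g t w) ↔ w.1 n = y := by
  have hlt' : ∀ k < n, w.1 k ∉ ({y} : Set E) := fun k hk h => hlt k hk (by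
    rw [mem_singleton_iff.1 h]; exact hy)
  constructor
  · intro h
    by_contra hne
    have h1 := hw.clock_le_hitTime hg (A := {y}) (n := n + 1) (fun k hk => by
      rcases Nat.lt_succ_iff_lt_or_eq.1 hk with hk | rfl
      · exact hlt' k hk
      · simpa using hne)
    rw [← h, hw.hitTime_eq hg hn hlt, ENNReal.ofReal_le_ofReal_iff
      (hw.clock_nonneg (fun x => (hg x).le) n)] at h1
    exact absurd (hw.clock_strictMono hg (Nat.lt_succ_self n)) (not_lt.2 h1)
  · intro h
    rw [hw.hitTime_eq hg hn hlt, hw.hitTime_eq hg (by simpa using h) hlt']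

lemma IsRegularPath.returnTime_eq (hg : ∀ x, 0 < g x) (hw : IsRegularPath g w)
    (h01 : w.1 1 ≠ w.1 0) (A : Set E) :
    returnTime A (fun t => pathAt g t w) =
      ENNReal.ofReal (clock g w 1) + hitTime A (fun t => pathAt g t (tailPath w)) := by
  have hg' : ∀ x, 0 ≤ g x := fun x => (hg x).le
  obtain ⟨b, hbc⟩ : ∃ b : ℝ≥0, (b : ℝ) = clock g w 1 :=
    ⟨_, Real.coe_toNNReal _ (hw.clock_nonneg hg' 1)⟩
  have hb0 : 0 < b := by
    have := hw.clock_strictMono hg Nat.zero_lt_one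
    rwa [clock_zero, ← hbc, NNReal.coe_pos] at this
  have hb : (b : ℝ) = w.2 0 * g (w.1 0) := by simp [hbc, clock]
  have hstart : pathAt g 0 w = w.1 0 :=
    hw.pathAt_eq hg' (by simp) (by simpa [← hbc] using hb0)
  have hpath : ∀ t, b ≤ t → pathAt g t w = pathAt g (t - b) (tailPath w) := fun t ht => by
    conv_lhs => rw [← consPath_tailPath w]
    exact hw.tail.pathAt_consPath hb ht
  have hset : {t : ℝ≥0 | 0 < t ∧ pathAt g t w ∈ A ∧
      ∃ s, 0 < s ∧ s < t ∧ pathAt g s w ≠ pathAt g 0 w} =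
      (fun u => b + u) '' {u | 0 < u ∧ pathAt g u (tailPath w) ∈ A} := by
    ext t
    simp only [mem_ofPred_eq, mem_image]
    constructor
    · rintro ⟨_, hA, s, _, hst, hne⟩
      have hbs : b ≤ s := by
        by_contra! hsb
        refine hne (hstart ▸ hw.pathAt_eq hg' (by simp) ?_)
        rw [zero_add, ← hbc]
        exact NNReal.coe_lt_coe.2 hsb
      have hbt : b < t := hbs.trans_lt hst
      exact ⟨t - b, ⟨tsub_pos_of_lt hbt, by rwa [← hpath t hbt.le]⟩, add_tsub_cancel_of_le hbt.le⟩
    · rintro ⟨u, ⟨hu, hA⟩, rfl⟩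
      refine ⟨by positivity, by rwa [hpath _ le_self_add, add_tsub_cancel_left], b, hb0,
        lt_add_of_pos_right b hu, ?_⟩
      rw [hstart, hw.pathAt_eq hg' hbc.ge (n := 1)
        (by rw [hbc]; exact hw.clock_strictMono hg (Nat.lt_succ_self 1))]
      exact h01
  unfold returnTime hitTime
  rw [hset, image_image]
  have : ENNReal.ofReal (clock g w 1) = (b : ℝ≥0∞) := by
    rw [← hbc, ENNReal.ofReal_coe_nnreal]
  rw [this, sInf_image, sInf_image, ENNReal.add_iInf₂]
  simp

end Hitting

/-! ### The trace of a regular path -/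

section Trace

variable {Ω : Type*} {g : E → ℝ} {w : JumpPath E} {h : E → ℝ≥0} {X : ℝ≥0 → Ω → E} {ω : Ω}

lemma additiveFunctional_mono (h : E → ℝ≥0) (X : ℝ≥0 → Ω → E) (ω : Ω) :
    Monotone fun t => additiveFunctional h X t ω := fun _ _ hst =>
  lintegral_mono_set (Icc_subset_Icc_right (NNReal.coe_le_coe.2 hst))

lemma IsRegularPath.lintegral_eq_add (hg : ∀ x, 0 ≤ g x) (hw : IsRegularPath g w)
    (hX : ∀ t, X t ω = pathAt g t w) {n : ℕ} {t : ℝ} (h1 : clock g w n ≤ t)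
    (h2 : t ≤ clock g w (n + 1)) :
    ∫⁻ s in Ico 0 t, (h (X s.toNNReal ω) : ℝ≥0∞) =
      (∫⁻ s in Ico 0 (clock g w n), (h (X s.toNNReal ω) : ℝ≥0∞)) +
        h (w.1 n) * ENNReal.ofReal (t - clock g w n) := by
  have h0 := hw.clock_nonneg hg n
  rw [← Ico_union_Ico_eq_Ico h0 h1, lintegral_union measurableSet_Ico
    (Ico_disjoint_Ico.2 (by simp [h0]))]
  congr 1
  rw [setLIntegral_congr_fun measurableSet_Ico (g := fun _ => (h (w.1 n) : ℝ≥0∞))]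
  · simp
  · intro s hs
    have hs0 : 0 ≤ s := h0.trans hs.1
    simp only [hX]
    rw [hw.pathAt_eq hg (n := n)]
    · rw [Real.coe_toNNReal _ hs0]; exact hs.1
    · rw [Real.coe_toNNReal _ hs0]; exact hs.2.trans_le h2

lemma IsRegularPath.lintegral_clock (hg : ∀ x, 0 ≤ g x) (hw : IsRegularPath g w)
    (hX : ∀ t, X t ω = pathAt g t w) (n : ℕ) :
    ∫⁻ s in Ico 0 (clock g w n), (h (X s.toNNReal ω) : ℝ≥0∞) =
      ENNReal.ofReal (clock (fun x => h x * g x) w n) := by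
  induction n with
  | zero => simp
  | succ n ih =>
    rw [hw.lintegral_eq_add hg hX (hw.clock_mono hg n.le_succ) le_rfl, ih, clock_succ g,
      clock_succ (fun x => h x * g x), ENNReal.ofReal_add, add_sub_cancel_left]
    · congr 1
      rw [← ENNReal.ofReal_coe_nnreal, ← ENNReal.ofReal_mul (h (w.1 n)).coe_nonneg]
      congr 1
      ring
    · exact Finset.sum_nonneg fun i _ => mul_nonneg (hw.pos i).le
        (mul_nonneg (h _).coe_nonneg (hg _))
    · exact mul_nonneg (hw.pos n).le (mul_nonneg (h _).coe_nonneg (hg _))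

lemma IsRegularPath.additiveFunctional_eq (hg : ∀ x, 0 ≤ g x) (hw : IsRegularPath g w)
    (hX : ∀ t, X t ω = pathAt g t w) {n : ℕ} {t : ℝ≥0} (h1 : clock g w n ≤ t)
    (h2 : (t : ℝ) ≤ clock g w (n + 1)) :
    additiveFunctional h X t ω =
      ENNReal.ofReal (clock (fun x => h x * g x) w n + h (w.1 n) * (t - clock g w n)) := by
  rw [additiveFunctional, setLIntegral_congr Ico_ae_eq_Icc.symm, hw.lintegral_eq_add hg hX h1 h2,
    hw.lintegral_clock hg hX, ENNReal.ofReal_add, ENNReal.ofReal_mul (NNReal.coe_nonneg _),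
    ENNReal.ofReal_coe_nnreal]
  · exact Finset.sum_nonneg fun i _ => mul_nonneg (hw.pos i).le
      (mul_nonneg (h _).coe_nonneg (hg _))
  · exact mul_nonneg (h _).coe_nonneg (sub_nonneg.2 h1)

lemma IsRegularPath.additiveFunctional_lt_top (hg : ∀ x, 0 ≤ g x) (hw : IsRegularPath g w)
    (hX : ∀ t, X t ω = pathAt g t w) (t : ℝ≥0) : additiveFunctional h X t ω < ∞ := by
  rw [hw.additiveFunctional_eq hg hX (clock_jumpIndex_le t) (hw.lt_clock_jumpIndex t).le]
  exact ENNReal.ofReal_lt_top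

lemma IsRegularPath.tendsto_additiveFunctional (hg : ∀ x, 0 ≤ g x) (hw : IsRegularPath g w)
    (hw' : IsRegularPath (fun x => h x * g x) w) (hX : ∀ t, X t ω = pathAt g t w) :
    Tendsto (fun t => additiveFunctional h X t ω) atTop (𝓝 ∞) := by
  rw [ENNReal.tendsto_nhds_top_iff_nnreal]
  intro c
  obtain ⟨n, hn⟩ := hw'.exists_lt_clock c
  obtain ⟨b, hb⟩ : ∃ b : ℝ≥0, (b : ℝ) = clock g w (n + 1) :=
    ⟨_, Real.coe_toNNReal _ (hw.clock_nonneg hg _)⟩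
  filter_upwards [eventually_ge_atTop b] with t ht
  refine lt_of_lt_of_le ?_ (additiveFunctional_mono h X ω ht)
  dsimp only
  rw [hw.additiveFunctional_eq hg hX (n := n + 1) hb.ge
    (by rw [hb]; exact hw.clock_mono hg (n + 1).le_succ), hb, ← ENNReal.ofReal_coe_nnreal]
  refine (ENNReal.ofReal_lt_ofReal_iff_of_nonneg c.coe_nonneg).2 ?_
  simpa using hn

/-- The trace is the path of the same jump construction with the holding factor multiplied
by `h`. -/
lemma IsRegularPath.hTrace_eq (hg : ∀ x, 0 < g x) (hw : IsRegularPath g w)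
    (hw' : IsRegularPath (fun x => h x * g x) w) (hX : ∀ t, X t ω = pathAt g t w) (t : ℝ≥0) :
    hTrace h X t ω = pathAt (fun x => h x * g x) t w := by
  have hg' : ∀ x, 0 ≤ g x := fun x => (hg x).le
  have hgh : ∀ x, 0 ≤ (h x : ℝ) * g x := fun x => mul_nonneg (h x).coe_nonneg (hg' x)
  set n := jumpIndex (fun x => h x * g x) t w with hn
  have h1 : clock (fun x => h x * g x) w n ≤ t := clock_jumpIndex_le t
  have h2 := hw'.lt_clock_jumpIndex t
  rw [← hn, clock_succ] at h2
  have hpos : 0 < (h (w.1 n) : ℝ) :=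
    pos_of_mul_pos_left (hw'.pathAt_pos hgh t) (hg' _)
  set s : ℝ := clock g w n + (t - clock (fun x => h x * g x) w n) / h (w.1 n) with hs
  have hs1 : clock g w n ≤ s := by
    have : 0 ≤ (t - clock (fun x => h x * g x) w n) / h (w.1 n) :=
      div_nonneg (sub_nonneg.2 h1) hpos.le
    linarith
  have hs2 : s < clock g w (n + 1) := by
    rw [clock_succ, hs, add_lt_add_iff_left, div_lt_iff₀ hpos]
    nlinarith
  have hs0 : 0 ≤ s := (hw.clock_nonneg hg' n).trans hs1
  have hval : ∀ r : ℝ≥0, s ≤ r → (r : ℝ) ≤ clock g w (n + 1) →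
      additiveFunctional h X r ω = ENNReal.ofReal (t + h (w.1 n) * (r - s)) := by
    intro r hr1 hr2
    rw [hw.additiveFunctional_eq hg' hX (hs1.trans hr1) hr2]
    congr 1
    rw [hs]
    field_simp
    ring
  obtain ⟨σ, hσ⟩ : ∃ σ : ℝ≥0, (σ : ℝ) = s := ⟨_, Real.coe_toNNReal _ hs0⟩
  obtain ⟨b, hb⟩ : ∃ b : ℝ≥0, (b : ℝ) = clock g w (n + 1) :=
    ⟨_, Real.coe_toNNReal _ (hw.clock_nonneg hg' _)⟩
  have hS : inverseFunctional h X t ω = σ := by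
    refine IsGreatest.csSup_eq ⟨?_, ?_⟩
    · rw [mem_ofPred_eq, hval σ hσ.ge (hσ.trans_le hs2.le), hσ]
      simp
    · intro r hr
      by_contra! hlt
      have hsr : s < r := hσ ▸ NNReal.coe_lt_coe.2 hlt
      set r' : ℝ≥0 := min r b with hr'
      have hr's : s < r' := by
        rw [hr', NNReal.coe_min]
        exact lt_min hsr (hs2.trans_eq hb.symm)
      have hle : additiveFunctional h X r' ω ≤ t :=
        (additiveFunctional_mono h X ω (min_le_left _ _)).trans hr
      rw [hval r' hr's.le (by rw [hr', NNReal.coe_min]; exact (min_le_right _ _).trans hb.le),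
        ← ENNReal.ofReal_coe_nnreal, ENNReal.ofReal_le_ofReal_iff t.coe_nonneg] at hle
      have := mul_pos hpos (sub_pos.2 hr's)
      linarith
  rw [hTrace, hS, hX, hw.pathAt_eq hg' (n := n) (hs1.trans hσ.ge) (hσ.trans_lt hs2)]
  rfl

end Trace

end HTrace

end

noncomputable section

namespace HTrace

variable {E : Type*}

/-! ### Measurability -/

section Measurability

variable [MeasurableSpace E]

lemma measurable_consPath (x : E) :
    Measurable fun q : ℝ × JumpPath E => consPath x q.1 q.2 := by
  refine Measurable.prodMk (measurable_pi_lambda _ fun n => ?_)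
    (measurable_pi_lambda _ fun n => ?_)
  · cases n
    · exact measurable_const
    · exact (measurable_pi_apply _).comp (measurable_fst.comp measurable_snd)
  · cases n
    · exact measurable_fst
    · exact (measurable_pi_apply _).comp (measurable_snd.comp measurable_snd)

lemma measurable_tailPath : Measurable (tailPath : JumpPath E → JumpPath E) := by
  refine Measurable.prodMk (measurable_pi_lambda _ fun n => ?_)
    (measurable_pi_lambda _ fun n => ?_)
  · exact (measurable_pi_apply _).comp measurable_fst
  · exact (measurable_pi_apply _).comp measurable_snd

variable [DiscreteMeasurableSpace E]

lemma measurable_clock (g : E → ℝ) (n : ℕ) : Measurable fun w : JumpPath E => clock g w n := by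
  refine Finset.measurable_sum _ fun i _ => Measurable.mul ?_ ?_
  · exact (measurable_pi_apply i).comp measurable_snd
  · exact (Measurable.of_discrete (f := g)).comp ((measurable_pi_apply i).comp measurable_fst)

lemma measurable_sInf_nat {α : Type*} [MeasurableSpace α] {S : ℕ → Set α}
    (hS : ∀ n, MeasurableSet (S n)) : Measurable fun a => sInf {n | a ∈ S n} := by
  refine measurable_of_Iic fun m => ?_
  have : (fun a => sInf {n | a ∈ S n}) ⁻¹' Iic m =
      (⋃ n ≤ m, S n) ∪ (⋃ n, S n)ᶜ := by
    ext a
    simp only [mem_preimage, mem_Iic, mem_union, mem_iUnion, mem_compl_iff, exists_prop]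
    constructor
    · intro h
      by_cases hne : ∃ n, a ∈ S n
      · exact Or.inl ⟨_, h, Nat.sInf_mem (s := {n | a ∈ S n}) hne⟩
      · exact Or.inr hne
    · rintro (⟨n, hn, ha⟩ | h)
      · exact (Nat.sInf_le (s := {n | a ∈ S n}) ha).trans hn
      · have : {n | a ∈ S n} = ∅ := by
          ext n
          simpa using fun hn => h ⟨n, hn⟩
        simp [this]
  rw [this]
  exact (MeasurableSet.biUnion (to_countable _) fun n _ => hS n).union
    (MeasurableSet.iUnion hS).compl

lemma measurable_jumpIndex (g : E → ℝ) :
    Measurable fun q : ℝ≥0 × JumpPath E => jumpIndex g q.1 q.2 :=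
  measurable_sInf_nat (S := fun n => {q : ℝ≥0 × JumpPath E | (q.1 : ℝ) < clock g q.2 (n + 1)})
    fun n => measurableSet_lt measurable_fst.coe_nnreal_real
      ((measurable_clock g (n + 1)).comp measurable_snd)

lemma measurable_pathAt (g : E → ℝ) :
    Measurable fun q : ℝ≥0 × JumpPath E => pathAt g q.1 q.2 := by
  have h : Measurable fun q : ℕ × (ℕ → E) => q.2 q.1 :=
    measurable_from_prod_countable_right fun n => measurable_pi_apply n
  exact h.comp ((measurable_jumpIndex g).prodMk (measurable_fst.comp measurable_snd))

lemma measurable_pathAt_right (g : E → ℝ) (t : ℝ≥0) : Measurable (pathAt g t) :=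
  (measurable_pathAt g).comp measurable_prodMk_left

lemma measurable_path (g : E → ℝ) : Measurable fun (w : JumpPath E) (t : ℝ≥0) => pathAt g t w :=
  measurable_pi_lambda _ fun t => measurable_pathAt_right g t

lemma measurableSet_isRegularPath (g : E → ℝ) :
    MeasurableSet {w : JumpPath E | IsRegularPath g w} := by
  have : {w : JumpPath E | IsRegularPath g w} =
      (⋂ i, {w | 0 < w.2 i}) ∩ ⋂ m : ℕ, ⋃ N, ⋂ n ≥ N, {w | (m : ℝ) ≤ clock g w n} := by
    ext w
    simp only [mem_inter_iff, mem_iInter, mem_iUnion, mem_ofPred_eq]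
    constructor
    · intro hw
      exact ⟨hw.pos, fun m => eventually_atTop.1 (hw.tendsto.eventually_ge_atTop (m : ℝ))⟩
    · rintro ⟨h1, h2⟩
      refine ⟨h1, tendsto_atTop.2 fun b => ?_⟩
      obtain ⟨m, hm⟩ := exists_nat_ge b
      exact (eventually_atTop.2 (h2 m)).mono fun n hn => hm.trans hn
  rw [this]
  refine (MeasurableSet.iInter fun i => ?_).inter (MeasurableSet.iInter fun m =>
    MeasurableSet.iUnion fun N => MeasurableSet.biInter (to_countable _) fun n _ => ?_)
  · exact measurableSet_lt measurable_const ((measurable_pi_apply i).comp measurable_snd)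
  · exact measurableSet_le measurable_const (measurable_clock g n)

end Measurability

/-! ### The law of the jump construction -/

/-- The law of the trajectory after the first jump. -/
def stepLaw [MeasurableSpace E] (p : E → E → ℝ) (Q : E → Measure (JumpPath E)) (η : E) :
    Measure (JumpPath E) :=
  Measure.sum fun ξ => ENNReal.ofReal (p η ξ) • Q ξ

/-- The laws `Q η` of the pair formed by a Markov chain with transition probabilities `p` started
from `η` and by independent exponential clocks, described by their decomposition at the first
jump. -/
structure IsJumpLaw [MeasurableSpace E] (p : E → E → ℝ) (Q : E → Measure (JumpPath E)) :
    Prop where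
  prob : ∀ η, IsProbabilityMeasure (Q η)
  step : ∀ η, Q η = ((expMeasure 1).prod (stepLaw p Q η)).map fun q => consPath η q.1 q.2

instance : IsProbabilityMeasure (expMeasure 1) := isProbabilityMeasure_expMeasure one_pos

/-- The law of independent mean one exponential clocks. -/
def clockLaw : Measure (ℕ → ℝ) := Measure.infinitePi fun _ => expMeasure 1

instance : IsProbabilityMeasure clockLaw := by unfold clockLaw; infer_instance

lemma measurable_natCons {α : Type*} [MeasurableSpace α] :
    Measurable fun q : α × (ℕ → α) => (fun n => Nat.casesOn n q.1 q.2 : ℕ → α) := by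
  refine measurable_pi_lambda _ fun n => ?_
  cases n
  · exact measurable_fst
  · exact (measurable_pi_apply _).comp measurable_snd

lemma clockLaw_eq_map_natCons :
    ((expMeasure 1).prod clockLaw).map (fun q => (fun n => Nat.casesOn n q.1 q.2 : ℕ → ℝ)) =
      clockLaw := by
  refine Measure.eq_infinitePi _ fun s t ht => ?_
  classical
  rw [Measure.map_apply measurable_natCons
    (MeasurableSet.pi (Finset.countable_toSet s) fun i _ => ht i)]
  set s' : Finset ℕ := s.preimage Nat.succ (Nat.succ_injective.injOn) with hs'
  have hpre : (fun q : ℝ × (ℕ → ℝ) => (fun n => Nat.casesOn n q.1 q.2 : ℕ → ℝ)) ⁻¹'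
      Set.pi (s : Set ℕ) t =
      (if 0 ∈ s then t 0 else univ) ×ˢ Set.pi (s' : Set ℕ) (fun n => t (n + 1)) := by
    ext q
    simp only [mem_preimage, Set.mem_pi, mem_prod, Finset.mem_coe, hs', Finset.mem_preimage]
    constructor
    · intro h
      refine ⟨?_, fun i hi => h (i + 1) hi⟩
      split_ifs with h0
      · exact h 0 h0
      · trivial
    · rintro ⟨h0, h1⟩ n hn
      cases n with
      | zero => simpa [hn] using h0
      | succ n => exact h1 n hn
  rw [hpre, Measure.prod_prod, clockLaw, Measure.infinitePi_pi _ fun i _ => ht (i + 1)]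
  have hprod : ∏ i ∈ s', expMeasure 1 (t (i + 1)) =
      ∏ i ∈ s.erase 0, expMeasure 1 (t i) := by
    rw [hs']
    refine Finset.prod_bij (fun i _ => i + 1) ?_ ?_ ?_ ?_
    · intro i hi
      simpa using hi
    · intro i _ j _ h
      omega
    · intro i hi
      rw [Finset.mem_erase] at hi
      obtain ⟨k, rfl⟩ := Nat.exists_eq_succ_of_ne_zero hi.1
      exact ⟨k, by simpa using hi.2, rfl⟩
    · intro i _
      rfl
  rw [hprod]
  split_ifs with h0
  · exact Finset.mul_prod_erase s (fun i => expMeasure 1 (t i)) h0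
  · rw [measure_univ, one_mul, Finset.erase_eq_of_notMem h0]

section Cylinders

variable [Countable E] [MeasurableSpace E] [DiscreteMeasurableSpace E]

lemma measurableSet_cylinder (n : ℕ) (x : ℕ → E) :
    MeasurableSet {y : ℕ → E | ∀ i ≤ n, y i = x i} := by
  have : {y : ℕ → E | ∀ i ≤ n, y i = x i} = ⋂ i ≤ n, (fun y => y i) ⁻¹' {x i} := by
    ext y; simp
  rw [this]
  exact MeasurableSet.biInter (to_countable _) fun i _ =>
    measurable_pi_apply i (measurableSet_singleton _)

/-- Laws of sequences in a countable space agree if they agree on cylinders. -/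
lemma measure_ext_of_cylinder {μ ν : Measure (ℕ → E)} [IsFiniteMeasure μ]
    (huniv : μ univ = ν univ)
    (h : ∀ (n : ℕ) (x : ℕ → E), μ {y | ∀ i ≤ n, y i = x i} = ν {y | ∀ i ≤ n, y i = x i}) :
    μ = ν := by
  refine ext_of_generate_finite
    (range fun q : ℕ × (ℕ → E) => {y : ℕ → E | ∀ i ≤ q.1, y i = q.2 i}) ?_ ?_ ?_ huniv
  · apply le_antisymm
    · refine iSup_le fun n => ?_
      rintro _ ⟨A, -, rfl⟩
      have : (fun y : ℕ → E => y n) ⁻¹' A =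
          ⋃ f ∈ {f : Fin (n + 1) → E | f (Fin.last n) ∈ A},
            {y : ℕ → E | ∀ i ≤ n, y i = f (Fin.ofNat (n + 1) i)} := by
        ext y
        simp only [mem_preimage, mem_ofPred_eq, mem_iUnion, exists_prop]
        constructor
        · intro hy
          refine ⟨fun i => y i, by simpa using hy, fun i hi => ?_⟩
          simp [Nat.mod_eq_of_lt (Nat.lt_succ_of_le hi)]
        · rintro ⟨f, hf, hy⟩
          rw [hy n le_rfl]
          convert hf
          ext
          simp
      rw [this]
      exact MeasurableSet.biUnion (to_countable _) fun f _ =>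
        MeasurableSpace.measurableSet_generateFrom ⟨(n, fun i => f (Fin.ofNat (n + 1) i)), rfl⟩
    · refine MeasurableSpace.generateFrom_le ?_
      rintro _ ⟨q, rfl⟩
      exact measurableSet_cylinder _ _
  · rintro _ ⟨q, rfl⟩ _ ⟨r, rfl⟩ ⟨z, hz1, hz2⟩
    refine ⟨(max q.1 r.1, z), ?_⟩
    ext y
    simp only [mem_ofPred_eq, mem_inter_iff] at hz1 hz2 ⊢
    constructor
    · intro hy
      exact ⟨fun i hi => (hy i (hi.trans (le_max_left _ _))).trans (hz1 i hi),
        fun i hi => (hy i (hi.trans (le_max_right _ _))).trans (hz2 i hi)⟩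
    · rintro ⟨h1, h2⟩ i hi
      rcases le_max_iff.1 hi with hi | hi
      · rw [h1 i hi, hz1 i hi]
      · rw [h2 i hi, hz2 i hi]
  · rintro _ ⟨q, rfl⟩
    exact h _ _

end Cylinders

section Construction

variable {Ω : Type*} [MeasurableSpace E] [MeasurableSpace Ω] {p : E → E → ℝ} {P : E → Measure Ω} {Y : ℕ → Ω → E} {e : ℕ → Ω → ℝ}

/-- The trajectory of the jump construction at `ω`. -/
def samplePath (Y : ℕ → Ω → E) (e : ℕ → Ω → ℝ) (ω : Ω) : JumpPath E :=
  (fun n => Y n ω, fun n => e n ω)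

lemma IsJumpConstruction.measurable_chain_seq (hY : IsJumpConstruction p P Y e) :
    Measurable fun ω n => Y n ω :=
  measurable_pi_lambda _ hY.measurable_chain

lemma IsJumpConstruction.measurable_samplePath (hY : IsJumpConstruction p P Y e) :
    Measurable (samplePath Y e) :=
  hY.measurable_chain_seq.prodMk (measurable_pi_lambda _ hY.measurable_exp)

section

variable [∀ η, IsProbabilityMeasure (P η)]

lemma IsJumpConstruction.map_samplePath (hY : IsJumpConstruction p P Y e) (η : E) :
    (P η).map (samplePath Y e) = ((P η).map fun ω n => Y n ω).prod clockLaw := by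
  have h1 := (indepFun_iff_map_prod_eq_prod_map_map hY.measurable_chain_seq.aemeasurable
    (measurable_pi_lambda _ hY.measurable_exp).aemeasurable).1 (hY.chain_indep_exp η)
  have h2 := (hY.exp_indep η).map_fun_eq_infinitePi_map hY.measurable_exp
  simp_rw [hY.exp_law η] at h2
  rw [h2] at h1
  exact h1

end

variable [Countable E] [DiscreteMeasurableSpace E]

lemma IsJumpConstruction.cylinder_law (hY : IsJumpConstruction p P Y e) (η : E) (n : ℕ)
    (x : ℕ → E) [Decidable (x 0 = η)] :
    (P η).map (fun ω n => Y n ω) {y | ∀ i ≤ n, y i = x i} =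
      if x 0 = η then ∏ i ∈ Finset.range n, ENNReal.ofReal (p (x i) (x (i + 1))) else 0 := by
  rw [Measure.map_apply hY.measurable_chain_seq (measurableSet_cylinder n x)]
  convert hY.chain_law η n x
  rfl

lemma IsJumpConstruction.tsum_eq_one (hY : IsJumpConstruction p P Y e) (η : E) :
    ∑' ξ, ENNReal.ofReal (p η ξ) = 1 := by
  classical
  have h : ∀ ξ, P η {ω | Y 0 ω = η ∧ Y 1 ω = ξ} = ENNReal.ofReal (p η ξ) := fun ξ => by
    have := hY.chain_law η 1 (fun n => if n = 0 then η else ξ)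
    simp only [if_true, Finset.range_one, Finset.prod_singleton, zero_add, one_ne_zero,
      if_false] at this
    rw [← this]
    congr 1
    ext ω
    constructor
    · rintro ⟨h0, h1⟩ i hi
      interval_cases i <;> simp [h0, h1]
    · intro h
      exact ⟨by simpa using h 0 (by norm_num), by simpa using h 1 le_rfl⟩
  have h0 : P η {ω | Y 0 ω = η} = 1 := by
    have := hY.chain_law η 0 (fun _ => η)
    simpa using this
  simp_rw [← h]
  rw [← measure_iUnion, ← h0]
  · congr 1
    ext ω
    simp
  · intro ξ ξ' hne
    refine disjoint_left.2 fun ω h1 h2 => hne ?_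
    exact h1.2.symm.trans h2.2
  · intro ξ
    exact (hY.measurable_chain 0 (measurableSet_singleton η)).inter
      (hY.measurable_chain 1 (measurableSet_singleton ξ))

variable [∀ η, IsProbabilityMeasure (P η)]

lemma IsJumpConstruction.chain_step (hY : IsJumpConstruction p P Y e) (η : E) :
    (P η).map (fun ω n => Y n ω) =
      (Measure.sum fun ξ => ENNReal.ofReal (p η ξ) • (P ξ).map (fun ω n => Y n ω)).map
        fun x => (fun n => Nat.casesOn n η x : ℕ → E) := by
  classical
  have hm : Measurable fun x : ℕ → E => (fun n => Nat.casesOn n η x : ℕ → E) :=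
    measurable_natCons.comp (measurable_const.prodMk measurable_id)
  have hpr : ∀ η, IsProbabilityMeasure ((P η).map (fun ω n => Y n ω)) := fun η =>
    Measure.isProbabilityMeasure_map hY.measurable_chain_seq.aemeasurable
  refine measure_ext_of_cylinder ?_ fun n x => ?_
  · rw [Measure.map_apply hm MeasurableSet.univ, preimage_univ,
      Measure.sum_apply _ MeasurableSet.univ]
    simp [hY.tsum_eq_one]
  · rw [hY.cylinder_law, Measure.map_apply hm (measurableSet_cylinder n x)]
    by_cases hx : x 0 = η
    · rw [if_pos hx]
      cases n with
      | zero =>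
        have : (fun x : ℕ → E => (fun n => Nat.casesOn n η x : ℕ → E)) ⁻¹'
            {y | ∀ i ≤ 0, y i = x i} = univ := by
          ext y
          simp [hx]
        rw [this, Measure.sum_apply _ MeasurableSet.univ]
        simp [hY.tsum_eq_one]
      | succ n =>
        have : (fun x : ℕ → E => (fun n => Nat.casesOn n η x : ℕ → E)) ⁻¹'
            {y | ∀ i ≤ n + 1, y i = x i} = {y | ∀ i ≤ n, y i = x (i + 1)} := by
          ext y
          simp only [mem_preimage, mem_ofPred_eq]
          constructor
          · intro h i hi
            exact h (i + 1) (by omega)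
          · intro h i hi
            cases i with
            | zero => exact hx.symm
            | succ i => exact h i (by omega)
        rw [this, Measure.sum_apply _ (measurableSet_cylinder n fun i => x (i + 1))]
        simp_rw [Measure.smul_apply, hY.cylinder_law]
        rw [tsum_eq_single (x 1)]
        · simp [Finset.prod_range_succ', hx, mul_comm]
        · intro ξ hξ
          simp [Ne.symm hξ]
    · rw [if_neg hx]
      have : (fun x : ℕ → E => (fun n => Nat.casesOn n η x : ℕ → E)) ⁻¹'
          {y | ∀ i ≤ n, y i = x i} = ∅ := by
        ext y
        simp only [mem_preimage, mem_ofPred_eq, mem_empty_iff_false, iff_false]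
        intro h
        exact hx (h 0 (Nat.zero_le _)).symm
      rw [this, measure_empty]

/-- The law of a jump construction is decomposed at its first jump. -/
lemma IsJumpConstruction.isJumpLaw (hY : IsJumpConstruction p P Y e) :
    IsJumpLaw p fun η => (P η).map (samplePath Y e) := by
  refine ⟨fun η => Measure.isProbabilityMeasure_map hY.measurable_samplePath.aemeasurable,
    fun η => ?_⟩
  have hpr : ∀ η, IsProbabilityMeasure ((P η).map (fun ω n => Y n ω)) := fun η =>
    Measure.isProbabilityMeasure_map hY.measurable_chain_seq.aemeasurable
  have hm : Measurable fun x : ℕ → E => (fun n => Nat.casesOn n η x : ℕ → E) :=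
    measurable_natCons.comp (measurable_const.prodMk measurable_id)
  set κ := Measure.sum fun ξ => ENNReal.ofReal (p η ξ) • (P ξ).map (fun ω n => Y n ω) with hκ
  have hstep : stepLaw p (fun η => (P η).map (samplePath Y e)) η = κ.prod clockLaw := by
    rw [hκ, Measure.prod_sum_left, stepLaw]
    simp_rw [hY.map_samplePath, Measure.prod_smul_left]
  have hprκ := hpr η
  rw [hY.chain_step η, ← hκ] at hprκ
  rw [hstep, hY.map_samplePath, hY.chain_step η, ← hκ]
  refine Measure.prod_eq fun s t hs ht => ?_
  rw [Measure.map_apply (measurable_consPath η) (hs.prod ht),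
    Measure.prod_apply (measurable_consPath η (hs.prod ht))]
  have hsec : ∀ a : ℝ, Prod.mk a ⁻¹' ((fun q : ℝ × JumpPath E => consPath η q.1 q.2) ⁻¹' s ×ˢ t) =
      ((fun x : ℕ → E => (fun n => Nat.casesOn n η x : ℕ → E)) ⁻¹' s) ×ˢ
        (Prod.mk a ⁻¹' ((fun q : ℝ × (ℕ → ℝ) => (fun n => Nat.casesOn n q.1 q.2 : ℕ → ℝ)) ⁻¹' t)) :=
    fun a => rfl
  simp_rw [hsec, Measure.prod_prod]
  rw [lintegral_const_mul _ (measurable_measure_prodMk_left (measurable_natCons ht)),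
    ← Measure.prod_apply (measurable_natCons ht), ← Measure.map_apply hm hs,
    ← Measure.map_apply measurable_natCons ht, clockLaw_eq_map_natCons]

end Construction

end HTrace

end

noncomputable section

namespace HTrace

variable {E : Type*}

/-! ### The exponential law -/

lemma lintegral_expMeasure (φ : ℝ → ℝ≥0∞) (hφ : Measurable φ) :
    ∫⁻ a, φ a ∂(expMeasure 1) = ∫⁻ a in Ici 0, ENNReal.ofReal (Real.exp (-a)) * φ a := by
  change ∫⁻ a, φ a ∂(volume.withDensity (exponentialPDF 1)) = _
  have hm : Measurable (exponentialPDF 1) :=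
    (measurable_exponentialPDFReal 1).ennreal_ofReal
  rw [lintegral_withDensity_eq_lintegral_mul _ hm hφ, ← lintegral_indicator measurableSet_Ici]
  refine lintegral_congr fun a => ?_
  by_cases ha : 0 ≤ a
  · simp [indicator_of_mem (mem_Ici.2 ha), exponentialPDF_of_nonneg ha]
  · rw [indicator_of_notMem (by simpa using ha), Pi.mul_apply,
      exponentialPDF_of_neg (not_le.1 ha), zero_mul]

/-- The exponential law is memoryless. -/
lemma lintegral_expMeasure_memoryless {c : ℝ} (hc : 0 ≤ c) {φ : ℝ → ℝ≥0∞} (hφ : Measurable φ) :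
    ∫⁻ a in Ioi c, φ (a - c) ∂(expMeasure 1) =
      ENNReal.ofReal (Real.exp (-c)) * ∫⁻ a, φ a ∂(expMeasure 1) := by
  have hφc : Measurable fun a => φ (a - c) := hφ.comp (measurable_id.sub_const c)
  have hφ' : Measurable fun a => ENNReal.ofReal (Real.exp (-a)) * φ a :=
    (Measurable.ennreal_ofReal (by fun_prop)).mul hφ
  rw [← lintegral_indicator measurableSet_Ioi, lintegral_expMeasure _
    (hφc.indicator measurableSet_Ioi), lintegral_expMeasure _ hφ,
    setLIntegral_congr Ioi_ae_eq_Ici.symm,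
    ← lintegral_const_mul _ hφ',
    ← lintegral_indicator measurableSet_Ioi,
    setLIntegral_congr Ioi_ae_eq_Ici.symm, ← lintegral_indicator measurableSet_Ioi,
    ← lintegral_sub_right_eq_self ((Ioi 0).indicator fun a =>
      ENNReal.ofReal (Real.exp (-c)) * (ENNReal.ofReal (Real.exp (-a)) * φ a)) c]
  refine lintegral_congr fun a => ?_
  by_cases ha : c < a
  · rw [indicator_of_mem (mem_Ioi.2 (hc.trans_lt ha)), indicator_of_mem (mem_Ioi.2 ha),
      indicator_of_mem (mem_Ioi.2 (sub_pos.2 ha)), ← mul_assoc,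
      ← ENNReal.ofReal_mul (Real.exp_pos _).le, ← Real.exp_add]
    congr 3
    ring
  · rw [indicator_of_notMem (s := Ioi (0 : ℝ)) (a := a - c) (by simpa using ha)]
    by_cases ha' : 0 < a
    · rw [indicator_of_mem (mem_Ioi.2 ha'), indicator_of_notMem (by simpa using ha), mul_zero]
    · rw [indicator_of_notMem (by simpa using ha')]

lemma expMeasure_Ioi {c : ℝ} (hc : 0 ≤ c) :
    expMeasure 1 (Ioi c) = ENNReal.ofReal (Real.exp (-c)) := by
  simpa using lintegral_expMeasure_memoryless hc (φ := fun _ => 1) measurable_const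

lemma ae_expMeasure_pos : ∀ᵐ a ∂(expMeasure 1), 0 < a := by
  have h := expMeasure_Ioi le_rfl
  simp only [neg_zero, Real.exp_zero, ENNReal.ofReal_one] at h
  exact (prob_compl_eq_zero_iff measurableSet_Ioi).2 h

lemma clockLaw_map_eval (n : ℕ) : clockLaw.map (fun e => e n) = expMeasure 1 :=
  Measure.infinitePi_map_eval _ n

lemma ae_clockLaw_pos : ∀ᵐ e ∂clockLaw, ∀ i, 0 < e i := by
  refine ae_all_iff.2 fun i => ?_
  have := ae_expMeasure_pos
  rw [← clockLaw_map_eval i] at this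
  exact ae_of_ae_map (measurable_pi_apply i).aemeasurable this

lemma ae_clockLaw_frequently {S : Set ℕ} (hS : S.Infinite) :
    ∀ᵐ e ∂clockLaw, ∃ᶠ n in atTop, n ∈ S ∧ 1 < e n := by
  classical
  set s : ℕ → Set (ℕ → ℝ) := fun n => (fun e => e n) ⁻¹' (if n ∈ S then Ioi 1 else ∅) with hs
  have hsm : ∀ n, MeasurableSet (s n) := fun n => measurable_pi_apply n (by
    split_ifs
    · exact measurableSet_Ioi
    · exact MeasurableSet.empty)
  have hind : iIndepSet s clockLaw := by
    rw [iIndepSet_iff_meas_biInter hsm]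
    intro t
    refine (iIndepFun_infinitePi (P := fun _ : ℕ => expMeasure 1) (X := fun _ a => a)
      (fun _ => measurable_id)).meas_biInter fun i _ => ⟨_, ?_, rfl⟩
    split_ifs
    · exact measurableSet_Ioi
    · exact MeasurableSet.empty
  have hsum : ∑' n, clockLaw (s n) = ∞ := by
    have : ∀ n : S, clockLaw (s n) = ENNReal.ofReal (Real.exp (-1)) := fun n => by
      rw [← expMeasure_Ioi zero_le_one, ← clockLaw_map_eval n,
        Measure.map_apply (measurable_pi_apply _) measurableSet_Ioi]
      simp [hs]
    have hinf : Infinite S := hS.to_subtype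
    refine top_unique ?_
    calc ∞ = ∑' n : S, clockLaw (s n) := by
          simp_rw [this]
          exact (ENNReal.tsum_const_eq_top_of_ne_zero (by simp [Real.exp_pos])).symm
      _ ≤ ∑' n, clockLaw (s n) := ENNReal.tsum_comp_le_tsum_of_injective Subtype.val_injective _
  have h1 := measure_limsup_eq_one hsm hind hsum
  have h2 : ∀ᵐ e ∂clockLaw, e ∈ limsup s atTop :=
    (prob_compl_eq_zero_iff (MeasurableSet.measurableSet_limsup hsm)).2 h1
  filter_upwards [h2] with e he
  rw [mem_limsup_iff_frequently_mem] at he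
  refine he.mono fun n hn => ?_
  by_cases hnS : n ∈ S
  · exact ⟨hnS, by simpa [hs, hnS] using hn⟩
  · simp [hs, hnS] at hn

lemma tendsto_atTop_of_frequently_add_le {f : ℕ → ℝ} (hf : Monotone f) {c : ℝ} (hc : 0 < c)
    (h : ∃ᶠ n in atTop, f n + c ≤ f (n + 1)) : Tendsto f atTop atTop := by
  have key : ∀ k : ℕ, ∃ n, f 0 + k * c ≤ f n := by
    intro k
    induction k with
    | zero => exact ⟨0, by simp⟩
    | succ k ih =>
      obtain ⟨n, hn⟩ := ih
      obtain ⟨m, hnm, hm⟩ := frequently_atTop.1 h n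
      refine ⟨m + 1, ?_⟩
      have := hf hnm
      push_cast
      linarith
  refine tendsto_atTop_atTop_of_monotone hf fun b => ?_
  obtain ⟨k, hk⟩ := exists_nat_ge ((b - f 0) / c)
  obtain ⟨n, hn⟩ := key k
  rw [div_le_iff₀ hc] at hk
  exact ⟨n, by linarith⟩

lemma ae_clockLaw_isRegularPath {g : E → ℝ} (hg : ∀ x, 0 ≤ g x) {ζ : E} (hζ : 0 < g ζ)
    {x : ℕ → E} (hx : ∃ᶠ n in atTop, x n = ζ) :
    ∀ᵐ e ∂clockLaw, IsRegularPath g (x, e) := by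
  filter_upwards [ae_clockLaw_pos, ae_clockLaw_frequently
    (S := {n | x n = ζ}) (Nat.frequently_atTop_iff_infinite.1 hx)] with e he1 he2
  refine ⟨he1, tendsto_atTop_of_frequently_add_le (c := g ζ) ?_ hζ ?_⟩
  · refine monotone_nat_of_le_succ fun n => ?_
    rw [clock_succ]
    linarith [mul_nonneg (he1 n).le (hg (x n))]
  · refine he2.mono fun n hn => ?_
    have : x n = ζ := hn.1
    rw [clock_succ]
    simp only [this]
    nlinarith [hn.2]

/-! ### Almost sure properties of the trajectories -/

lemma frequently_consPath_iff {η ζ : E} {a : ℝ} {w : JumpPath E} :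
    (∃ᶠ n in atTop, (consPath η a w).1 n = ζ) ↔ ∃ᶠ n in atTop, w.1 n = ζ := by
  conv_lhs => rw [← map_add_atTop_eq_nat 1, frequently_map]
  rfl

section JumpLaw

variable [MeasurableSpace E] {p : E → E → ℝ} {Q : E → Measure (JumpPath E)}

section Basic

variable [Countable E]

lemma ae_stepLaw {η : E} {Φ : JumpPath E → Prop} (h : ∀ ξ, ∀ᵐ w ∂(Q ξ), Φ w) :
    ∀ᵐ w ∂(stepLaw p Q η), Φ w :=
  Measure.ae_sum_iff.2 fun ξ => Measure.ae_smul_measure (h ξ) _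

lemma ae_of_ae_stepLaw {η ξ : E} (hp : 0 < p η ξ) {Φ : JumpPath E → Prop}
    (h : ∀ᵐ w ∂(stepLaw p Q η), Φ w) : ∀ᵐ w ∂(Q ξ), Φ w :=
  (Measure.ae_ennreal_smul_measure_iff (ENNReal.ofReal_pos.2 hp).ne').1 (Measure.ae_sum_iff.1 h ξ)

lemma IsJumpLaw.sFinite_stepLaw (hQ : IsJumpLaw p Q) (η : E) : SFinite (stepLaw p Q η) := by
  have := hQ.prob
  unfold stepLaw
  infer_instance

lemma IsJumpLaw.isProbabilityMeasure_stepLaw (hQ : IsJumpLaw p Q) (η : E) :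
    IsProbabilityMeasure (stepLaw p Q η) := by
  have := hQ.prob
  have := hQ.sFinite_stepLaw η
  have h := measure_univ (μ := Q η)
  rw [hQ.step η, Measure.map_apply (measurable_consPath η) MeasurableSet.univ, preimage_univ,
    ← univ_prod_univ, Measure.prod_prod, measure_univ, one_mul] at h
  exact ⟨h⟩

lemma IsJumpLaw.lintegral_eq (hQ : IsJumpLaw p Q) (η : E) {f : JumpPath E → ℝ≥0∞}
    (hf : Measurable f) :
    ∫⁻ w, f w ∂(Q η) = ∫⁻ a, ∫⁻ w, f (consPath η a w) ∂(stepLaw p Q η) ∂(expMeasure 1) := by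
  have := hQ.sFinite_stepLaw η
  conv_lhs => rw [hQ.step η]
  rw [lintegral_map hf (measurable_consPath η),
    lintegral_prod (fun q : ℝ × JumpPath E => f (consPath η q.1 q.2))
      (hf.comp (measurable_consPath η)).aemeasurable]

lemma IsJumpLaw.apply_eq (hQ : IsJumpLaw p Q) (η : E) {S : Set (JumpPath E)}
    (hS : MeasurableSet S) :
    Q η S = ∫⁻ a, stepLaw p Q η {w | consPath η a w ∈ S} ∂(expMeasure 1) := by
  have := hQ.sFinite_stepLaw η
  conv_lhs => rw [hQ.step η]
  rw [Measure.map_apply (measurable_consPath η) hS,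
    Measure.prod_apply (measurable_consPath η hS)]
  rfl

lemma IsJumpLaw.ae_iff (hQ : IsJumpLaw p Q) (η : E) {Φ : JumpPath E → Prop}
    (hΦ : MeasurableSet {w | Φ w}) :
    (∀ᵐ w ∂(Q η), Φ w) ↔
      ∀ᵐ a ∂(expMeasure 1), ∀ᵐ w ∂(stepLaw p Q η), Φ (consPath η a w) := by
  have := hQ.sFinite_stepLaw η
  conv_lhs => rw [hQ.step η]
  rw [ae_map_iff (measurable_consPath η).aemeasurable hΦ,
    Measure.ae_prod_iff_ae_ae
      (p := fun q : ℝ × JumpPath E => Φ (consPath η q.1 q.2)) (measurable_consPath η hΦ)]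

lemma IsJumpLaw.map_tailPath (hQ : IsJumpLaw p Q) (η : E) :
    (Q η).map tailPath = stepLaw p Q η := by
  have := hQ.sFinite_stepLaw η
  conv_lhs => rw [hQ.step η]
  rw [Measure.map_map measurable_tailPath (measurable_consPath η)]
  change Measure.map Prod.snd _ = _
  rw [Measure.map_snd_prod, measure_univ, one_smul]

end Basic

variable [Countable E] [DiscreteMeasurableSpace E]

lemma measurableSet_start (n : ℕ) (ζ : E) : MeasurableSet {w : JumpPath E | w.1 n = ζ} :=
  have h : Measurable fun w : JumpPath E => w.1 n := (measurable_pi_apply n).comp measurable_fst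
  h (measurableSet_singleton ζ)

lemma IsJumpLaw.ae_start (hQ : IsJumpLaw p Q) (η : E) : ∀ᵐ w ∂(Q η), w.1 0 = η := by
  rw [hQ.ae_iff η (measurableSet_start 0 η)]
  exact ae_of_all _ fun a => ae_of_all _ fun w => rfl

lemma IsJumpLaw.ae_first_jump (hQ : IsJumpLaw p Q) {η : E} (hp : p η η = 0) :
    ∀ᵐ w ∂(Q η), w.1 1 ≠ w.1 0 := by
  have hS : MeasurableSet {w : JumpPath E | w.1 1 ≠ w.1 0} :=
    (measurableSet_eq_fun ((measurable_pi_apply 1).comp measurable_fst)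
      ((measurable_pi_apply 0).comp measurable_fst)).compl
  rw [hQ.ae_iff η hS]
  refine ae_of_all _ fun a => Measure.ae_sum_iff.2 fun ξ => ?_
  rcases eq_or_ne ξ η with rfl | hne
  · simp [hp]
  · refine Measure.ae_smul_measure ?_ _
    filter_upwards [hQ.ae_start ξ] with w hw
    change w.1 0 ≠ η
    rwa [hw]

lemma measurableSet_frequently (ζ : E) :
    MeasurableSet {w : JumpPath E | ∃ᶠ n in atTop, w.1 n = ζ} := by
  have : {w : JumpPath E | ∃ᶠ n in atTop, w.1 n = ζ} =
      ⋂ N : ℕ, ⋃ n ≥ N, {w : JumpPath E | w.1 n = ζ} := by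
    ext w
    simp [frequently_atTop]
  rw [this]
  exact MeasurableSet.iInter fun N => MeasurableSet.biUnion (to_countable _)
    fun n _ => measurableSet_start n ζ

/-- Recurrence of a state is inherited by all the states it leads to. -/
lemma IsJumpLaw.ae_frequently_of_pos (hQ : IsJumpLaw p Q) {ζ ξ : E} (n : ℕ) :
    ∀ η, 0 < Q η {w | w.1 n = ξ} → (∀ᵐ w ∂(Q η), ∃ᶠ n in atTop, w.1 n = ζ) →
      ∀ᵐ w ∂(Q ξ), ∃ᶠ n in atTop, w.1 n = ζ := by
  have := hQ.prob
  induction n with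
  | zero =>
    intro η hpos h
    by_cases hne : η = ξ
    · rwa [← hne]
    · have : Q η {w | w.1 0 = ξ} = 0 := by
        refine measure_mono_null (fun w (hw : w.1 0 = ξ) => ?_) (hQ.ae_start η)
        simpa [hw] using Ne.symm hne
      exact absurd this hpos.ne'
  | succ n ih =>
    intro η hpos h
    rw [hQ.ae_iff η (measurableSet_frequently ζ)] at h
    simp_rw [frequently_consPath_iff] at h
    have hstep : ∀ᵐ w ∂(stepLaw p Q η), ∃ᶠ n in atTop, w.1 n = ζ := h.exists.choose_spec
    rw [hQ.apply_eq η (measurableSet_start _ _)] at hpos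
    have : ∀ a, stepLaw p Q η {w | consPath η a w ∈ {w : JumpPath E | w.1 (n + 1) = ξ}} =
        ∑' ξ', ENNReal.ofReal (p η ξ') * Q ξ' {w | w.1 n = ξ} := fun a => by
      rw [stepLaw, Measure.sum_apply]
      · rfl
      · exact measurableSet_start n ξ
    simp_rw [this] at hpos
    rw [lintegral_const, measure_univ, mul_one] at hpos
    obtain ⟨ξ', hξ'⟩ : ∃ ξ', ENNReal.ofReal (p η ξ') * Q ξ' {w | w.1 n = ξ} ≠ 0 := by
      by_contra! h0
      simp [h0] at hpos
    rw [mul_ne_zero_iff] at hξ'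
    exact ih ξ' (pos_iff_ne_zero.2 hξ'.2)
      (ae_of_ae_stepLaw (by simpa using hξ'.1) hstep)

end JumpLaw

section Construction

variable {Ω : Type*} [Countable E] [MeasurableSpace E] [DiscreteMeasurableSpace E]
  [MeasurableSpace Ω] {p : E → E → ℝ} {P : E → Measure Ω} {Y : ℕ → Ω → E} {e : ℕ → Ω → ℝ}
  [∀ η, IsProbabilityMeasure (P η)]

/-- In an irreducible recurrent chain every state is visited infinitely often. -/
lemma IsJumpConstruction.ae_frequently (hY : IsJumpConstruction p P Y e)
    (hirr : IsIrreducibleOn univ P Y) (hrec : IsRecurrentOn univ P Y) (η ζ : E) :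
    ∀ᵐ w ∂((P η).map (samplePath Y e)), ∃ᶠ n in atTop, w.1 n = ζ := by
  obtain ⟨n, hn⟩ := hirr ζ (mem_univ _) η (mem_univ _)
  refine hY.isJumpLaw.ae_frequently_of_pos n ζ ?_ ?_
  · rwa [Measure.map_apply hY.measurable_samplePath (measurableSet_start n η)]
  · rw [ae_map_iff hY.measurable_samplePath.aemeasurable (measurableSet_frequently ζ)]
    exact hrec ζ (mem_univ _)

lemma IsJumpConstruction.ae_isRegularPath (hY : IsJumpConstruction p P Y e)
    (hirr : IsIrreducibleOn univ P Y) (hrec : IsRecurrentOn univ P Y) {g : E → ℝ}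
    (hg : ∀ x, 0 ≤ g x) {ζ : E} (hζ : 0 < g ζ) (η : E) :
    ∀ᵐ w ∂((P η).map (samplePath Y e)), IsRegularPath g w := by
  have h := hY.ae_frequently hirr hrec η ζ
  have hpr : IsProbabilityMeasure ((P η).map (fun ω n => Y n ω)) :=
    Measure.isProbabilityMeasure_map hY.measurable_chain_seq.aemeasurable
  rw [hY.map_samplePath] at h ⊢
  rw [Measure.ae_prod_iff_ae_ae (measurableSet_isRegularPath g)]
  rw [Measure.ae_prod_iff_ae_ae (measurableSet_frequently ζ)] at h
  filter_upwards [h] with x hx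
  exact ae_clockLaw_isRegularPath hg hζ hx.exists.choose_spec

end Construction

end HTrace

end

noncomputable section

namespace HTrace

variable {E : Type*}

/-! ### The Markov property at a fixed time -/

lemma jumpIndex_consPath_of_lt {g : E → ℝ} {w : JumpPath E} {x : E} {a : ℝ} {t : ℝ≥0}
    (h : (t : ℝ) < a * g x) : jumpIndex g t (consPath x a w) = 0 :=
  Nat.sInf_eq_zero.2 (Or.inl (by simp [clock_consPath_succ, h]))

/-- The path which stays at `x` up to time `b` and then follows `u`. -/
def holdThen (x : E) (b : ℝ≥0) (u : ℝ≥0 → E) : ℝ≥0 → E := fun s =>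
  if s < b then x else u (s - b)

lemma measurable_holdThen [MeasurableSpace E] (x : E) (b : ℝ≥0) : Measurable (holdThen x b) := by
  refine measurable_pi_lambda _ fun s => ?_
  unfold holdThen
  split_ifs
  · exact measurable_const
  · exact measurable_pi_apply _

lemma IsRegularPath.stopped_consPath {g : E → ℝ} {w : JumpPath E} (hw : IsRegularPath g w)
    {x : E} {a : ℝ} {b t : ℝ≥0} (hb : (b : ℝ) = a * g x) (h : b ≤ t) :
    (fun s => pathAt g (min s t) (consPath x a w)) =
      holdThen x b fun s => pathAt g (min s (t - b)) w := by
  funext s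
  unfold holdThen
  split_ifs with hs
  · refine pathAt_consPath_of_lt ?_
    rw [← hb, NNReal.coe_lt_coe]
    exact (min_le_left _ _).trans_lt hs
  · rw [hw.pathAt_consPath hb (le_min (not_lt.1 hs) h)]
    congr 1
    rcases le_total s t with hst | hst
    · rw [min_eq_left hst, min_eq_left (tsub_le_tsub_right hst b)]
    · rw [min_eq_right hst, min_eq_right (tsub_le_tsub_right hst b)]

lemma IsRegularPath.shifted_consPath {g : E → ℝ} {w : JumpPath E} (hw : IsRegularPath g w)
    {x : E} {a : ℝ} {b t : ℝ≥0} (hb : (b : ℝ) = a * g x) (h : b ≤ t) :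
    (fun s => pathAt g (t + s) (consPath x a w)) = fun s => pathAt g (t - b + s) w := by
  funext s
  rw [hw.pathAt_consPath hb (h.trans le_self_add), tsub_add_eq_add_tsub h]

lemma IsRegularPath.shifted_consPath_of_lt {g : E → ℝ} {w : JumpPath E} (hw : IsRegularPath g w)
    {x : E} (hx : 0 < g x) {a : ℝ} {t : ℝ≥0} (h : (t : ℝ) < a * g x) :
    (fun s => pathAt g (t + s) (consPath x a w)) =
      fun s => pathAt g s (consPath x (a - t / g x) w) := by
  funext s
  have hr : (a - t / g x) * g x = a * g x - t := by field_simp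
  obtain ⟨b, hb⟩ : ∃ b : ℝ≥0, (b : ℝ) = a * g x :=
    ⟨_, Real.coe_toNNReal _ (t.coe_nonneg.trans h.le)⟩
  have htb : t < b := by rwa [← NNReal.coe_lt_coe, hb]
  have hb' : ((b - t : ℝ≥0) : ℝ) = (a - t / g x) * g x := by
    rw [hr, NNReal.coe_sub htb.le, hb]
  by_cases hs : t + s < b
  · rw [pathAt_consPath_of_lt, pathAt_consPath_of_lt]
    · rw [← hb', NNReal.coe_lt_coe]
      exact lt_tsub_iff_left.2 hs
    · rw [← hb, NNReal.coe_lt_coe]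
      exact hs
  · rw [not_lt] at hs
    rw [hw.pathAt_consPath hb hs, hw.pathAt_consPath hb' (tsub_le_iff_left.2 hs)]
    congr 1
    rw [tsub_tsub_eq_add_tsub_of_le htb.le, add_comm]

section Markov

variable [MeasurableSpace E] [DiscreteMeasurableSpace E]
  {p : E → E → ℝ} {Q : E → Measure (JumpPath E)} {g : E → ℝ}

lemma measurable_stopped (g : E → ℝ) (t : ℝ≥0) :
    Measurable fun (w : JumpPath E) s => pathAt g (min s t) w :=
  measurable_pi_lambda _ fun s => measurable_pathAt_right g (min s t)

lemma measurable_shifted (g : E → ℝ) (t : ℝ≥0) :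
    Measurable fun (w : JumpPath E) s => pathAt g (t + s) w :=
  measurable_pi_lambda _ fun s => measurable_pathAt_right g (t + s)

lemma measurable_jumpIndex_right (g : E → ℝ) (t : ℝ≥0) : Measurable (jumpIndex (E := E) g t) :=
  (measurable_jumpIndex g).comp measurable_prodMk_left

lemma measurableSet_stopped_jumpIndex (g : E → ℝ) (t : ℝ≥0) (n : ℕ) {C : Set (ℝ≥0 → E)}
    (hC : MeasurableSet C) :
    MeasurableSet {w | (fun s => pathAt g (min s t) w) ∈ C ∧ jumpIndex g t w = n} :=
  (measurable_stopped g t hC).inter (measurable_jumpIndex_right g t (measurableSet_singleton n))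

lemma measurableSet_shifted (g : E → ℝ) (t : ℝ≥0) {B : Set (ℝ≥0 → E)} (hB : MeasurableSet B) :
    MeasurableSet {w : JumpPath E | (fun s => pathAt g (t + s) w) ∈ B} :=
  measurable_shifted g t hB

lemma measurableSet_path (g : E → ℝ) {B : Set (ℝ≥0 → E)} (hB : MeasurableSet B) :
    MeasurableSet {w : JumpPath E | (fun s => pathAt g s w) ∈ B} :=
  measurable_path g hB

variable [Countable E]

lemma IsJumpLaw.markov_jumpIndex_zero (hQ : IsJumpLaw p Q) (hg : ∀ x, 0 ≤ g x)
    (hreg : ∀ η, ∀ᵐ w ∂(Q η), IsRegularPath g w) (η : E) (t : ℝ≥0) {C B : Set (ℝ≥0 → E)}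
    (hC : MeasurableSet C) (hB : MeasurableSet B) :
    Q η ({w | (fun s => pathAt g (min s t) w) ∈ C ∧ jumpIndex g t w = 0} ∩
        {w | (fun s => pathAt g (t + s) w) ∈ B}) =
      ∫⁻ w in {w | (fun s => pathAt g (min s t) w) ∈ C ∧ jumpIndex g t w = 0},
        Q (pathAt g t w) {w' | (fun s => pathAt g s w') ∈ B} ∂(Q η) := by
  have hpr := hQ.isProbabilityMeasure_stepLaw η
  have hS := measurableSet_stopped_jumpIndex g t 0 hC
  have hK : Measurable fun w => Q (pathAt g t w) {w' | (fun s => pathAt g s w') ∈ B} :=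
    (Measurable.of_discrete (f := fun x => Q x {w' | (fun s => pathAt g s w') ∈ B})).comp
      (measurable_pathAt_right g t)
  rw [hQ.apply_eq η (hS.inter (measurableSet_shifted g t hB)), ← lintegral_indicator hS,
    hQ.lintegral_eq η (hK.indicator hS)]
  have hregs : ∀ᵐ w ∂(stepLaw p Q η), IsRegularPath g w := ae_stepLaw hreg
  by_cases hC' : (fun _ => η) ∈ C ∧ 0 < g η
  · obtain ⟨hC', hpos⟩ := hC'
    set c : ℝ := t / g η with hc
    have hc0 : 0 ≤ c := div_nonneg t.coe_nonneg hpos.le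
    set φ : ℝ → ℝ≥0∞ := fun a => stepLaw p Q η
      {w | (fun s => pathAt g s (consPath η a w)) ∈ B} with hφdef
    have hφ : Measurable φ :=
      measurable_measure_prodMk_left ((measurable_path g).comp (measurable_consPath η) hB)
    have hQB : Q η {w' | (fun s => pathAt g s w') ∈ B} = ∫⁻ a, φ a ∂(expMeasure 1) :=
      hQ.apply_eq η (measurableSet_path g hB)
    have hlt : ∀ a : ℝ, (t : ℝ) < a * g η ↔ c < a := fun a => by rw [hc, div_lt_iff₀ hpos]
    have hconst : ∀ a w, c < a → (fun s => pathAt g (min s t) (consPath η a w)) = fun _ => η :=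
      fun a w ha => funext fun s => pathAt_consPath_of_lt
        ((NNReal.coe_le_coe.2 (min_le_right s t)).trans_lt ((hlt a).2 ha))
    trans ∫⁻ a in Ioi c, φ (a - c) ∂(expMeasure 1)
    · rw [← lintegral_indicator measurableSet_Ioi]
      refine lintegral_congr_ae ?_
      filter_upwards [ae_expMeasure_pos] with a ha
      by_cases hac : c < a
      · rw [indicator_of_mem (mem_Ioi.2 hac)]
        refine measure_congr (eventuallyEq_set.2 ?_)
        filter_upwards [hregs] with w hw
        simp only [mem_ofPred_eq, mem_inter_iff, hconst a w hac, hC', true_and,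
          jumpIndex_consPath_of_lt ((hlt a).2 hac), hw.shifted_consPath_of_lt hpos ((hlt a).2 hac),
          hc]
      · rw [indicator_of_notMem (by simpa using hac)]
        refine measure_mono_null ?_ hregs
        intro w hw hw'
        obtain ⟨b, hb⟩ : ∃ b : ℝ≥0, (b : ℝ) = a * g η :=
          ⟨_, Real.coe_toNNReal _ (mul_nonneg ha.le hpos.le)⟩
        have hbt : b ≤ t := by
          rw [← NNReal.coe_le_coe, hb]
          exact not_lt.1 fun h => hac ((hlt a).1 h)
        have h0 : jumpIndex g t (consPath η a w) = 0 := hw.1.2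
        rw [IsRegularPath.jumpIndex_consPath hw' hb hbt] at h0
        omega
    · rw [lintegral_expMeasure_memoryless hc0 hφ, ← hQB, ← expMeasure_Ioi hc0,
        mul_comm, ← setLIntegral_const, ← lintegral_indicator measurableSet_Ioi]
      refine lintegral_congr_ae ?_
      filter_upwards [ae_expMeasure_pos] with a ha
      by_cases hac : c < a
      · rw [indicator_of_mem (mem_Ioi.2 hac)]
        have : ∀ w, ({w | (fun s => pathAt g (min s t) w) ∈ C ∧ jumpIndex g t w = 0}.indicator
            (fun w => Q (pathAt g t w) {w' | (fun s => pathAt g s w') ∈ B})) (consPath η a w) =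
            Q η {w' | (fun s => pathAt g s w') ∈ B} := fun w => by
          rw [indicator_of_mem, pathAt_consPath_of_lt ((hlt a).2 hac)]
          exact ⟨by rw [hconst a w hac]; exact hC', jumpIndex_consPath_of_lt ((hlt a).2 hac)⟩
        simp_rw [this]
        rw [lintegral_const, measure_univ, mul_one]
      · rw [indicator_of_notMem (by simpa using hac), eq_comm]
        refine (lintegral_congr_ae ?_).trans lintegral_zero
        filter_upwards [hregs] with w hw
        refine indicator_of_notMem (fun h => ?_) _
        obtain ⟨b, hb⟩ : ∃ b : ℝ≥0, (b : ℝ) = a * g η :=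
          ⟨_, Real.coe_toNNReal _ (mul_nonneg ha.le hpos.le)⟩
        have hbt : b ≤ t := by
          rw [← NNReal.coe_le_coe, hb]
          exact not_lt.1 fun h => hac ((hlt a).1 h)
        have h0 : jumpIndex g t (consPath η a w) = 0 := h.2
        rw [hw.jumpIndex_consPath hb hbt] at h0
        omega
  · have hout : ∀ a, 0 < a → ∀ w, IsRegularPath g w → consPath η a w ∉
        {w | (fun s => pathAt g (min s t) w) ∈ C ∧ jumpIndex g t w = 0} := by
      rintro a ha w hw ⟨h1, h2⟩
      by_cases hlt : (t : ℝ) < a * g η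
      · refine hC' ⟨?_, pos_of_mul_pos_right (t.coe_nonneg.trans_lt hlt) ha.le⟩
        convert h1 using 1
        exact funext fun s => (pathAt_consPath_of_lt
          ((NNReal.coe_le_coe.2 (min_le_right s t)).trans_lt hlt)).symm
      · obtain ⟨b, hb⟩ : ∃ b : ℝ≥0, (b : ℝ) = a * g η :=
          ⟨_, Real.coe_toNNReal _ (mul_nonneg ha.le (hg η))⟩
        have hbt : b ≤ t := by rwa [← NNReal.coe_le_coe, hb, ← not_lt]
        rw [hw.jumpIndex_consPath hb hbt] at h2
        omega
    refine lintegral_congr_ae ?_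
    filter_upwards [ae_expMeasure_pos] with a ha
    trans 0
    · exact measure_mono_null (fun w hw hw' => hout a ha w hw' hw.1) hregs
    · refine ((lintegral_congr_ae ?_).trans lintegral_zero).symm
      filter_upwards [hregs] with w hw
      exact indicator_of_notMem (hout a ha w hw) _

lemma IsJumpLaw.markov_jumpIndex (hQ : IsJumpLaw p Q) (hg : ∀ x, 0 ≤ g x)
    (hreg : ∀ η, ∀ᵐ w ∂(Q η), IsRegularPath g w) {B : Set (ℝ≥0 → E)} (hB : MeasurableSet B)
    (n : ℕ) : ∀ (η : E) (t : ℝ≥0) {C : Set (ℝ≥0 → E)}, MeasurableSet C →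
    Q η ({w | (fun s => pathAt g (min s t) w) ∈ C ∧ jumpIndex g t w = n} ∩
        {w | (fun s => pathAt g (t + s) w) ∈ B}) =
      ∫⁻ w in {w | (fun s => pathAt g (min s t) w) ∈ C ∧ jumpIndex g t w = n},
        Q (pathAt g t w) {w' | (fun s => pathAt g s w') ∈ B} ∂(Q η) := by
  induction n with
  | zero => exact fun η t C hC => hQ.markov_jumpIndex_zero hg hreg η t hC hB
  | succ n ih =>
    intro η t C hC
    have hS := measurableSet_stopped_jumpIndex g t (n + 1) hC
    have hK : ∀ t, Measurable fun w => Q (pathAt g t w) {w' | (fun s => pathAt g s w') ∈ B} :=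
      fun t => (Measurable.of_discrete (f := fun x => Q x {w' | (fun s => pathAt g s w') ∈ B})).comp
        (measurable_pathAt_right g t)
    rw [hQ.apply_eq η (hS.inter (measurableSet_shifted g t hB)), ← lintegral_indicator hS,
      hQ.lintegral_eq η ((hK t).indicator hS)]
    have hregs : ∀ᵐ w ∂(stepLaw p Q η), IsRegularPath g w := ae_stepLaw hreg
    refine lintegral_congr_ae ?_
    filter_upwards [ae_expMeasure_pos] with a ha
    obtain ⟨b, hb⟩ : ∃ b : ℝ≥0, (b : ℝ) = a * g η :=
      ⟨_, Real.coe_toNNReal _ (mul_nonneg ha.le (hg η))⟩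
    by_cases hbt : b ≤ t
    · set C' := holdThen η b ⁻¹' C with hC'
      have hC'm : MeasurableSet C' := measurable_holdThen η b hC
      have hS' := measurableSet_stopped_jumpIndex g (t - b) n hC'm
      have hmem : ∀ w, IsRegularPath g w →
          (consPath η a w ∈ {w | (fun s => pathAt g (min s t) w) ∈ C ∧ jumpIndex g t w = n + 1} ↔
            w ∈ {w | (fun s => pathAt g (min s (t - b)) w) ∈ C' ∧ jumpIndex g (t - b) w = n}) := by
        intro w hw
        simp only [mem_ofPred_eq, hw.stopped_consPath hb hbt, hw.jumpIndex_consPath hb hbt,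
          add_left_inj, hC', mem_preimage]
      trans stepLaw p Q η
        ({w | (fun s => pathAt g (min s (t - b)) w) ∈ C' ∧ jumpIndex g (t - b) w = n} ∩
          {w | (fun s => pathAt g (t - b + s) w) ∈ B})
      · refine measure_congr (eventuallyEq_set.2 ?_)
        filter_upwards [hregs] with w hw
        refine and_congr (hmem w hw) ?_
        rw [mem_ofPred_eq, mem_ofPred_eq, hw.shifted_consPath hb hbt]
      trans ∫⁻ w in {w | (fun s => pathAt g (min s (t - b)) w) ∈ C' ∧ jumpIndex g (t - b) w = n},
        Q (pathAt g (t - b) w) {w' | (fun s => pathAt g s w') ∈ B} ∂(stepLaw p Q η)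
      · rw [← lintegral_indicator hS', stepLaw, lintegral_sum_measure,
          Measure.sum_apply _ (hS'.inter (measurableSet_shifted g (t - b) hB))]
        refine tsum_congr fun ξ => ?_
        rw [Measure.smul_apply, lintegral_smul_measure, lintegral_indicator hS',
          ih ξ (t - b) hC'm]
      · rw [← lintegral_indicator hS']
        refine lintegral_congr_ae ?_
        filter_upwards [hregs] with w hw
        by_cases h : w ∈ {w | (fun s => pathAt g (min s (t - b)) w) ∈ C' ∧
            jumpIndex g (t - b) w = n}
        · rw [indicator_of_mem h, indicator_of_mem ((hmem w hw).2 h), hw.pathAt_consPath hb hbt]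
        · rw [indicator_of_notMem h, indicator_of_notMem (fun h' => h ((hmem w hw).1 h'))]
    · have hlt : (t : ℝ) < a * g η := by rw [← hb, NNReal.coe_lt_coe]; exact not_le.1 hbt
      have hout : ∀ w, consPath η a w ∉
          {w | (fun s => pathAt g (min s t) w) ∈ C ∧ jumpIndex g t w = n + 1} := fun w h => by
        have := h.2
        rw [jumpIndex_consPath_of_lt hlt] at this
        omega
      simp_rw [indicator_of_notMem (hout _), lintegral_zero]
      refine measure_mono_null (fun w hw => hout w hw.1) measure_empty

/-- The Markov property at a fixed time, for the canonical process. -/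
lemma IsJumpLaw.markov (hQ : IsJumpLaw p Q) (hg : ∀ x, 0 ≤ g x)
    (hreg : ∀ η, ∀ᵐ w ∂(Q η), IsRegularPath g w) (η : E) (t : ℝ≥0) {C B : Set (ℝ≥0 → E)}
    (hC : MeasurableSet C) (hB : MeasurableSet B) :
    Q η ({w | (fun s => pathAt g (min s t) w) ∈ C} ∩ {w | (fun s => pathAt g (t + s) w) ∈ B}) =
      ∫⁻ w in {w | (fun s => pathAt g (min s t) w) ∈ C},
        Q (pathAt g t w) {w' | (fun s => pathAt g s w') ∈ B} ∂(Q η) := by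
  have hS := fun n => measurableSet_stopped_jumpIndex g t n hC
  have hunion : {w | (fun s => pathAt g (min s t) w) ∈ C} =
      ⋃ n, {w | (fun s => pathAt g (min s t) w) ∈ C ∧ jumpIndex g t w = n} := by
    ext w
    simp
  have hdisj : Pairwise (Function.onFun Disjoint
      fun n => {w | (fun s => pathAt g (min s t) w) ∈ C ∧ jumpIndex g t w = n}) :=
    fun m n hmn => disjoint_left.2 fun w h1 h2 => hmn (h1.2.symm.trans h2.2)
  rw [hunion, lintegral_iUnion hS hdisj, iUnion_inter, measure_iUnion
    (fun m n hmn => (hdisj hmn).mono inter_subset_left inter_subset_left)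
    (fun n => (hS n).inter (measurableSet_shifted g t hB))]
  exact tsum_congr fun n => hQ.markov_jumpIndex hg hreg hB n η t hC

end Markov

end HTrace

end

noncomputable section

namespace HTrace

variable {E : Type*}

/-! ### From the Markov to the strong Markov property -/

section StrongMarkov

variable {Ω : Type*} [MeasurableSpace E] [mΩ : MeasurableSpace Ω] {Z : ℝ≥0 → Ω → E}
  {hZ : ∀ t, Measurable (Z t)} {τ : Ω → WithTop ℝ≥0}

lemma exists_stopped_of_measurableSet_naturalFiltration {t : ℝ≥0} {A : Set Ω}
    (hA : MeasurableSet[naturalFiltration Z hZ t] A) :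
    ∃ C : Set (ℝ≥0 → E), MeasurableSet C ∧ A = {ω | (fun s => Z (min s t) ω) ∈ C} := by
  have hle : (⨆ s ≤ t, MeasurableSpace.comap (Z s) inferInstance : MeasurableSpace Ω) ≤
      MeasurableSpace.comap (fun ω s => Z (min s t) ω) inferInstance := by
    refine iSup₂_le fun s hs => ?_
    rintro _ ⟨S, hS, rfl⟩
    refine ⟨(fun u => u s) ⁻¹' S, measurable_pi_apply s hS, ?_⟩
    ext ω
    simp [min_eq_left hs]
  obtain ⟨C, hC, rfl⟩ := hle A hA
  exact ⟨C, hC, rfl⟩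

lemma measurableSet_ne_top (hτ : IsStoppingTime (naturalFiltration Z hZ) τ) :
    MeasurableSet {ω | τ ω ≠ ⊤} := by
  have : {ω | τ ω ≠ ⊤} = ⋃ n : ℕ, {ω | τ ω ≤ ((n : ℝ≥0) : WithTop ℝ≥0)} := by
    ext ω
    simp only [mem_ofPred_eq, mem_iUnion]
    constructor
    · intro h
      obtain ⟨c, hc⟩ := WithTop.ne_top_iff_exists.1 h
      obtain ⟨n, hn⟩ := exists_nat_ge c
      exact ⟨n, by rw [← hc]; exact_mod_cast hn⟩
    · rintro ⟨n, hn⟩ h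
      rw [h] at hn
      exact absurd hn (by simp)
  rw [this]
  exact MeasurableSet.iUnion fun n => (naturalFiltration Z hZ).le _ _ (hτ n)

lemma measurable_untopD (hτ : IsStoppingTime (naturalFiltration Z hZ) τ) :
    Measurable fun ω => (τ ω).untopD 0 := by
  refine measurable_of_Iic fun c => ?_
  have : (fun ω => (τ ω).untopD 0) ⁻¹' Iic c = {ω | τ ω ≤ c} ∪ {ω | τ ω ≠ ⊤}ᶜ := by
    ext ω
    simp only [mem_preimage, mem_Iic, mem_union, mem_ofPred_eq, mem_compl_iff, not_not]
    cases h : τ ω using WithTop.recTopCoe with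
    | top => simp only [WithTop.untopD_top, zero_le, or_true]
    | coe a => simp only [WithTop.untopD_coe, WithTop.coe_le_coe, WithTop.coe_ne_top, or_false]
  rw [this]
  exact ((naturalFiltration Z hZ).le _ _ (hτ c)).union (measurableSet_ne_top hτ).compl

/-- The discretization of a time from above. -/
def timeCeil (k : ℕ) (t : ℝ≥0) : ℝ≥0 := (⌊((k : ℝ≥0) + 1) * t⌋₊ + 1) / ((k : ℝ≥0) + 1)

lemma lt_timeCeil (k : ℕ) (t : ℝ≥0) : t < timeCeil k t := by
  rw [timeCeil, lt_div_iff₀ (by positivity), mul_comm]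
  exact Nat.lt_floor_add_one _

lemma timeCeil_le (k : ℕ) (t : ℝ≥0) : timeCeil k t ≤ t + 1 / ((k : ℝ≥0) + 1) := by
  rw [timeCeil, add_div]
  gcongr
  rw [div_le_iff₀ (by positivity), mul_comm t]
  exact Nat.floor_le zero_le

lemma tendsto_timeCeil_add (t u : ℝ≥0) :
    Tendsto (fun k => timeCeil k t + u) atTop (𝓝[>] (t + u)) := by
  refine tendsto_nhdsWithin_iff.2 ⟨?_, Eventually.of_forall fun k => ?_⟩
  · refine Tendsto.add_const u (tendsto_of_tendsto_of_tendsto_of_le_of_le tendsto_const_nhds ?_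
      (fun k => (lt_timeCeil k t).le) (fun k => timeCeil_le k t))
    simpa using tendsto_const_nhds.add (tendsto_one_div_add_atTop_nhds_zero_nat (𝕜 := ℝ≥0))
  · exact add_lt_add_left (lt_timeCeil k t) u

lemma measurable_timeCeil (k : ℕ) : Measurable (timeCeil k) := by
  unfold timeCeil
  have : Measurable fun t : ℝ≥0 => ⌊((k : ℝ≥0) + 1) * t⌋₊ :=
    Nat.measurable_floor.comp (measurable_id.const_mul _)
  exact ((measurable_from_nat.comp this).add_const 1).div_const _

lemma measurableSet_floor_eq (hτ : IsStoppingTime (naturalFiltration Z hZ) τ) {A : Set Ω}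
    (hA : MeasurableSet[hτ.measurableSpace] A) (k j : ℕ) :
    MeasurableSet[naturalFiltration Z hZ (((j : ℝ≥0) + 1) / ((k : ℝ≥0) + 1))]
      (A ∩ {ω | τ ω ≠ ⊤} ∩ {ω | ⌊((k : ℝ≥0) + 1) * (τ ω).untopD 0⌋₊ = j}) := by
  set c : ℝ≥0 := ((j : ℝ≥0) + 1) / ((k : ℝ≥0) + 1) with hc
  set d : ℝ≥0 := (j : ℝ≥0) / ((k : ℝ≥0) + 1) with hd
  have hdc : d ≤ c := by rw [hd, hc]; gcongr; exact le_self_add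
  have heq : A ∩ {ω | τ ω ≠ ⊤} ∩ {ω | ⌊((k : ℝ≥0) + 1) * (τ ω).untopD 0⌋₊ = j} =
      (A ∩ {ω | τ ω ≤ c}) ∩ {ω | τ ω < c} ∩ {ω | τ ω < d}ᶜ := by
    ext ω
    simp only [mem_inter_iff, mem_ofPred_eq, mem_compl_iff, not_lt]
    cases h : τ ω using WithTop.recTopCoe with
    | top => simp only [ne_eq, not_true, and_false, false_and, not_top_lt]
    | coe a =>
      have hfl : ⌊((k : ℝ≥0) + 1) * a⌋₊ = j ↔ d ≤ a ∧ a < c := by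
        rw [Nat.floor_eq_iff zero_le, hc, hd, div_le_iff₀ (by positivity),
          lt_div_iff₀ (by positivity), mul_comm a]
      simp only [ne_eq, WithTop.coe_ne_top, not_false_eq_true, and_true,
        WithTop.untopD_coe, WithTop.coe_le_coe, WithTop.coe_lt_coe, hfl]
      constructor
      · rintro ⟨h1, h2, h3⟩
        exact ⟨⟨⟨h1, h3.le⟩, h3⟩, h2⟩
      · rintro ⟨⟨⟨h1, _⟩, h3⟩, h2⟩
        exact ⟨h1, h2, h3⟩
  rw [heq]
  exact ((hA.2 c).inter (hτ.measurableSet_lt c)).inter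
    ((naturalFiltration Z hZ).mono hdc _ (hτ.measurableSet_lt d)).compl

variable {μ : Measure Ω} {Z' : ℝ≥0 → Ω → E}

lemma aemeasurable_shift (hZ' : Measurable fun q : ℝ≥0 × Ω => Z' q.1 q.2)
    (hZZ' : ∀ᵐ ω ∂μ, ∀ t, Z t ω = Z' t ω) {T : Ω → ℝ≥0} (hT : Measurable T) :
    AEMeasurable (fun ω t => Z (T ω + t) ω) μ := by
  refine ⟨fun ω t => Z' (T ω + t) ω, ?_, ?_⟩
  · exact measurable_pi_lambda _ fun t => hZ'.comp ((hT.add_const t).prodMk measurable_id)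
  · filter_upwards [hZZ'] with ω hω
    exact funext fun t => hω _

variable {K : E → Measure (ℝ≥0 → E)}

/-- The strong Markov property at the discretized stopping times. -/
lemma strong_markov_timeCeil
    (hmarkov : ∀ (t : ℝ≥0) (A : Set Ω), MeasurableSet[naturalFiltration Z hZ t] A →
      ∀ B : Set (ℝ≥0 → E), MeasurableSet B →
        μ (A ∩ {ω | (fun s => Z (t + s) ω) ∈ B}) = ∫⁻ ω in A, K (Z t ω) B ∂μ)
    (hτ : IsStoppingTime (naturalFiltration Z hZ) τ) {A : Set Ω}
    (hA : MeasurableSet[hτ.measurableSpace] A) {B : Set (ℝ≥0 → E)} (hB : MeasurableSet B)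
    (k : ℕ) :
    μ (A ∩ {ω | τ ω ≠ ⊤} ∩ {ω | (fun t => Z (timeCeil k ((τ ω).untopD 0) + t) ω) ∈ B}) =
      ∫⁻ ω in A ∩ {ω | τ ω ≠ ⊤}, K (Z (timeCeil k ((τ ω).untopD 0)) ω) B ∂μ := by
  set S : ℕ → Set Ω := fun j =>
    A ∩ {ω | τ ω ≠ ⊤} ∩ {ω | ⌊((k : ℝ≥0) + 1) * (τ ω).untopD 0⌋₊ = j} with hSdef
  set c : ℕ → ℝ≥0 := fun j => ((j : ℝ≥0) + 1) / ((k : ℝ≥0) + 1) with hc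
  have hS : ∀ j, MeasurableSet[naturalFiltration Z hZ (c j)] (S j) :=
    measurableSet_floor_eq hτ hA k
  have hS' : ∀ j, MeasurableSet (S j) := fun j => (naturalFiltration Z hZ).le _ _ (hS j)
  have hceil : ∀ j, ∀ ω ∈ S j, timeCeil k ((τ ω).untopD 0) = c j := fun j ω hω => by
    have : ⌊((k : ℝ≥0) + 1) * (τ ω).untopD 0⌋₊ = j := hω.2
    rw [timeCeil, this]
  have hunion : A ∩ {ω | τ ω ≠ ⊤} = ⋃ j, S j := by
    ext ω
    simp [hSdef]
  have hdisj : Pairwise (Function.onFun Disjoint S) :=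
    fun i j hij => disjoint_left.2 fun ω h1 h2 => hij (h1.2.symm.trans h2.2)
  have hfix : ∀ j, S j ∩ {ω | (fun t => Z (timeCeil k ((τ ω).untopD 0) + t) ω) ∈ B} =
      S j ∩ {ω | (fun t => Z (c j + t) ω) ∈ B} := fun j => by
    ext ω
    refine and_congr_right fun hω => ?_
    rw [mem_ofPred_eq, mem_ofPred_eq, hceil j ω hω]
  have hmeas : ∀ j, MeasurableSet {ω | (fun t => Z (c j + t) ω) ∈ B} := fun j =>
    (measurable_pi_lambda (fun ω t => Z (c j + t) ω) fun t => hZ (c j + t)) hB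
  rw [hunion, iUnion_inter, lintegral_iUnion hS' hdisj, measure_iUnion
    (fun i j hij => (hdisj hij).mono inter_subset_left inter_subset_left)
    (fun j => by rw [hfix j]; exact (hS' j).inter (hmeas j))]
  refine tsum_congr fun j => ?_
  rw [hfix j, hmarkov (c j) (S j) (hS j) B hB]
  exact setLIntegral_congr_fun (hS' j) fun ω hω => by simp only [hceil j ω hω]

variable [DiscreteMeasurableSpace E]

lemma aemeasurable_kernel (hZ' : Measurable fun q : ℝ≥0 × Ω => Z' q.1 q.2)
    (hZZ' : ∀ᵐ ω ∂μ, ∀ t, Z t ω = Z' t ω) {T : Ω → ℝ≥0} (hT : Measurable T) :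
    AEMeasurable (fun ω => K (Z (T ω) ω)) μ := by
  have h : AEMeasurable (fun ω => Z (T ω) ω) μ := by
    refine ⟨fun ω => Z' (T ω) ω, hZ'.comp (hT.prodMk measurable_id), ?_⟩
    filter_upwards [hZZ'] with ω hω
    exact hω _
  exact (Measurable.of_discrete (f := K)).comp_aemeasurable h

/-- A process with a jointly measurable version and right-continuous paths (for the discrete
topology) which is Markov at fixed times is strong Markov. -/
lemma strong_markov_of_markov [IsProbabilityMeasure μ] [∀ x, IsProbabilityMeasure (K x)]
    (hZ' : Measurable fun q : ℝ≥0 × Ω => Z' q.1 q.2)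
    (hZZ' : ∀ᵐ ω ∂μ, ∀ t, Z t ω = Z' t ω)
    (hrc : ∀ᵐ ω ∂μ, ∀ t, ∀ᶠ s in 𝓝[>] t, Z s ω = Z t ω)
    (hmarkov : ∀ (t : ℝ≥0) (A : Set Ω), MeasurableSet[naturalFiltration Z hZ t] A →
      ∀ B : Set (ℝ≥0 → E), MeasurableSet B →
        μ (A ∩ {ω | (fun s => Z (t + s) ω) ∈ B}) = ∫⁻ ω in A, K (Z t ω) B ∂μ)
    (hτ : IsStoppingTime (naturalFiltration Z hZ) τ) {A : Set Ω}
    (hA : MeasurableSet[hτ.measurableSpace] A) {B : Set (ℝ≥0 → E)} (hB : MeasurableSet B) :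
    μ (A ∩ {ω | τ ω ≠ ⊤} ∩ {ω | (fun t => Z ((τ ω).untopD 0 + t) ω) ∈ B}) =
      ∫⁻ ω in A ∩ {ω | τ ω ≠ ⊤}, K (Z ((τ ω).untopD 0) ω) B ∂μ := by
  classical
  set T : Ω → ℝ≥0 := fun ω => (τ ω).untopD 0 with hTdef
  have hT : Measurable T := measurable_untopD hτ
  set S := A ∩ {ω | τ ω ≠ ⊤} with hSdef
  have hS : MeasurableSet S := (hτ.measurableSpace_le A hA).inter (measurableSet_ne_top hτ)
  have hTk : ∀ k, Measurable fun ω => timeCeil k (T ω) := fun k => (measurable_timeCeil k).comp hT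
  have hZZS : ∀ᵐ ω ∂(μ.restrict S), ∀ t, Z t ω = Z' t ω := ae_restrict_of_ae hZZ'
  have hθ : ∀ T : Ω → ℝ≥0, Measurable T →
      AEMeasurable (fun ω t => Z (T ω + t) ω) (μ.restrict S) := fun T hT =>
    aemeasurable_shift hZ' hZZS hT
  have hκ : ∀ T : Ω → ℝ≥0, Measurable T →
      AEMeasurable (fun ω => K (Z (T ω) ω)) (μ.restrict S) := fun T hT =>
    aemeasurable_kernel hZ' hZZS hT
  have hleft : ∀ (T : Ω → ℝ≥0), Measurable T → ∀ B, MeasurableSet B →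
      μ (S ∩ {ω | (fun t => Z (T ω + t) ω) ∈ B}) =
        (μ.restrict S).map (fun ω t => Z (T ω + t) ω) B := fun T hT B hB => by
    rw [Measure.map_apply_of_aemeasurable (hθ T hT) hB, Measure.restrict_apply' hS, inter_comm]
    rfl
  have hright : ∀ (T : Ω → ℝ≥0), Measurable T → ∀ B, MeasurableSet B →
      ∫⁻ ω in S, K (Z (T ω) ω) B ∂μ = (μ.restrict S).bind (fun ω => K (Z (T ω) ω)) B :=
    fun T hT B hB => (Measure.bind_apply hB (hκ T hT)).symm
  rw [hleft T hT B hB, hright T hT B hB]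
  congr 1
  refine ext_of_generate_finite _ generateFrom_squareCylinders.symm
    (isPiSystem_squareCylinders (fun _ => MeasurableSpace.isPiSystem_measurableSet)
      (fun _ => MeasurableSet.univ)) ?_ ?_
  · rintro B ⟨I, s, hs, rfl⟩
    have hsm : ∀ i, MeasurableSet (s i) := fun i => hs i (mem_univ i)
    have hBm : MeasurableSet ((I : Set ℝ≥0).pi s) :=
      MeasurableSet.pi (Finset.countable_toSet I) fun i _ => hsm i
    rw [← hleft T hT _ hBm, ← hright T hT _ hBm]
    have hrcS : ∀ᵐ ω ∂(μ.restrict S), ∀ u, ∀ᶠ k in atTop,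
        Z (timeCeil k (T ω) + u) ω = Z (T ω + u) ω := by
      filter_upwards [ae_restrict_of_ae hrc] with ω hω u
      exact (tendsto_timeCeil_add (T ω) u).eventually (hω (T ω + u))
    have hind : ∀ T : Ω → ℝ≥0, Measurable T →
        μ (S ∩ {ω | (fun t => Z (T ω + t) ω) ∈ (I : Set ℝ≥0).pi s}) =
          ∫⁻ ω in S, ((I : Set ℝ≥0).pi s).indicator 1 (fun t => Z (T ω + t) ω) ∂μ := by
      intro T hT
      rw [hleft T hT _ hBm, ← lintegral_indicator_one hBm,
        lintegral_map' (measurable_one.indicator hBm).aemeasurable (hθ T hT)]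
    have h1 : Tendsto (fun k => ∫⁻ ω in S, ((I : Set ℝ≥0).pi s).indicator 1
          (fun t => Z (timeCeil k (T ω) + t) ω) ∂μ) atTop
        (𝓝 (∫⁻ ω in S, ((I : Set ℝ≥0).pi s).indicator 1 (fun t => Z (T ω + t) ω) ∂μ)) := by
      refine tendsto_lintegral_of_dominated_convergence' (fun _ => 1) (fun k => ?_) (fun k => ?_)
        (by simp) ?_
      · exact (measurable_one.indicator hBm).comp_aemeasurable (hθ _ (hTk k))
      · exact ae_of_all _ fun ω => indicator_le_self' (fun _ _ => zero_le) _
      · filter_upwards [hrcS] with ω hω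
        refine tendsto_const_nhds.congr' ?_
        have : ∀ᶠ k in atTop, ∀ i ∈ I, Z (timeCeil k (T ω) + i) ω = Z (T ω + i) ω :=
          (Finset.eventually_all I).2 fun i _ => hω i
        filter_upwards [this] with k hk
        simp only [indicator, Set.mem_pi, Finset.mem_coe]
        congr 1
        exact propext (forall₂_congr fun i hi => by rw [hk i hi])
    have h2 : Tendsto (fun k => ∫⁻ ω in S, K (Z (timeCeil k (T ω)) ω) ((I : Set ℝ≥0).pi s) ∂μ)
        atTop (𝓝 (∫⁻ ω in S, K (Z (T ω) ω) ((I : Set ℝ≥0).pi s) ∂μ)) := by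
      refine tendsto_lintegral_of_dominated_convergence' (fun _ => 1) (fun k => ?_) (fun k => ?_)
        (by simp) ?_
      · exact (Measure.measurable_coe hBm).comp_aemeasurable (hκ _ (hTk k))
      · exact ae_of_all _ fun ω => prob_le_one
      · filter_upwards [hrcS] with ω hω
        refine tendsto_const_nhds.congr' ?_
        filter_upwards [hω 0] with k hk
        simp only [add_zero] at hk
        rw [hk]
    rw [hind T hT]
    refine tendsto_nhds_unique h1 (h2.congr fun k => ?_)
    rw [← hind _ (hTk k)]
    exact (strong_markov_timeCeil hmarkov hτ hA hBm k).symm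
  · rw [← hleft T hT _ MeasurableSet.univ, ← hright T hT _ MeasurableSet.univ]
    simp

end StrongMarkov

end HTrace

end

noncomputable section

namespace HTrace

variable {E Ω : Type*}

/-! ### Measurability of the trace -/

lemma lt_inverseFunctional_iff (h : E → ℝ≥0) (X : ℝ≥0 → Ω → E) (t c : ℝ≥0) (ω : Ω) :
    c < inverseFunctional h X t ω ↔ (∃ n : ℕ, ¬ additiveFunctional h X n ω ≤ t) ∧
      ∃ n : ℕ, additiveFunctional h X (c + 1 / ((n : ℝ≥0) + 1)) ω ≤ t := by
  have hmono := additiveFunctional_mono h X ω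
  have hbdd : BddAbove {s : ℝ≥0 | additiveFunctional h X s ω ≤ t} ↔
      ∃ n : ℕ, ¬ additiveFunctional h X n ω ≤ t := by
    constructor
    · rintro ⟨M, hM⟩
      obtain ⟨n, hn⟩ := exists_nat_gt M
      exact ⟨n, fun h => absurd (hM h) (not_le.2 hn)⟩
    · rintro ⟨n, hn⟩
      refine ⟨n, fun s hs => ?_⟩
      by_contra! hlt
      exact hn ((hmono hlt.le).trans hs)
  rw [← hbdd]
  constructor
  · intro hc
    refine ⟨?_, ?_⟩
    · by_contra hb
      rw [inverseFunctional, NNReal.sSup_of_not_bddAbove hb] at hc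
      exact absurd hc (not_lt.2 zero_le)
    · have hne : {s : ℝ≥0 | additiveFunctional h X s ω ≤ t}.Nonempty := by
        by_contra hemp
        rw [inverseFunctional, not_nonempty_iff_eq_empty.1 hemp, csSup_empty] at hc
        exact absurd hc (not_lt.2 bot_le)
      obtain ⟨s, hs, hcs⟩ := exists_lt_of_lt_csSup hne hc
      obtain ⟨n, hn⟩ := exists_nat_one_div_lt (tsub_pos_of_lt hcs)
      exact ⟨n, (hmono (lt_tsub_iff_left.1 hn).le).trans hs⟩
  · rintro ⟨hb, n, hn⟩
    refine lt_of_lt_of_le ?_ (le_csSup hb hn)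
    exact lt_add_of_pos_right c (by positivity)

section Measurability

variable [MeasurableSpace E] [DiscreteMeasurableSpace E] [MeasurableSpace Ω] {h : E → ℝ≥0}
  {X : ℝ≥0 → Ω → E}

lemma measurable_additiveFunctional (hX : Measurable fun q : ℝ≥0 × Ω => X q.1 q.2) (t : ℝ≥0) :
    Measurable (additiveFunctional h X t) := by
  have h1 : Measurable fun q : Ω × ℝ => (h (X q.2.toNNReal q.1) : ℝ≥0∞) :=
    ((Measurable.of_discrete (f := h)).comp (hX.comp
      ((measurable_real_toNNReal.comp measurable_snd).prodMk measurable_fst))).coe_nnreal_ennreal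
  exact h1.lintegral_prod_right'

lemma measurable_inverseFunctional (hX : Measurable fun q : ℝ≥0 × Ω => X q.1 q.2) (t : ℝ≥0) :
    Measurable (inverseFunctional h X t) := by
  refine measurable_of_Ioi fun c => ?_
  have : inverseFunctional h X t ⁻¹' Ioi c = (⋃ n : ℕ, {ω | additiveFunctional h X n ω ≤ t}ᶜ) ∩
      ⋃ n : ℕ, {ω | additiveFunctional h X (c + 1 / ((n : ℝ≥0) + 1)) ω ≤ t} := by
    ext ω
    simp only [mem_preimage, mem_Ioi, lt_inverseFunctional_iff, mem_inter_iff, mem_iUnion,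
      mem_compl_iff, mem_ofPred_eq]
  rw [this]
  exact (MeasurableSet.iUnion fun n =>
    (measurableSet_le (measurable_additiveFunctional hX _) measurable_const).compl).inter
    (MeasurableSet.iUnion fun n =>
      measurableSet_le (measurable_additiveFunctional hX _) measurable_const)

lemma measurable_hTrace (hX : Measurable fun q : ℝ≥0 × Ω => X q.1 q.2) (t : ℝ≥0) :
    Measurable (hTrace h X t) :=
  hX.comp ((measurable_inverseFunctional hX t).prodMk measurable_id)

end Measurability

/-! ### The chain and its trace as paths of the jump construction -/

section Chain

variable {R : E → E → ℝ} {Y : ℕ → Ω → E} {e : ℕ → Ω → ℝ}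

lemma IsRateMatrix.holdingRate_pos (hR : IsRateMatrix R) (x : E) : 0 < holdingRate R x :=
  neg_pos.2 (hR.diag_neg x)

lemma chain_eq_pathAt (t : ℝ≥0) (ω : Ω) :
    chain R Y e t ω = pathAt (fun x => (holdingRate R x)⁻¹) t (samplePath Y e ω) := by
  simp only [chain, timeChange, pathAt, jumpIndex, clock, samplePath, div_eq_mul_inv]

/-- The holding factor of the `h`-trace. -/
def traceFactor (R : E → E → ℝ) (h : E → ℝ≥0) (x : E) : ℝ := h x * (holdingRate R x)⁻¹

lemma IsRateMatrix.traceFactor_nonneg (hR : IsRateMatrix R) (h : E → ℝ≥0) (x : E) :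
    0 ≤ traceFactor R h x :=
  mul_nonneg (h x).coe_nonneg (inv_pos.2 (hR.holdingRate_pos x)).le

lemma IsRateMatrix.traceFactor_pos_iff (hR : IsRateMatrix R) {h : E → ℝ≥0} {x : E} :
    0 < traceFactor R h x ↔ x ∈ Function.support h := by
  rw [traceFactor, mul_pos_iff_of_pos_right (inv_pos.2 (hR.holdingRate_pos x)), NNReal.coe_pos,
    pos_iff_ne_zero, Function.mem_support]

/-- The trajectories along which the chain and its `h`-trace are well defined. -/
structure IsTraceablePath (R : E → E → ℝ) (h : E → ℝ≥0) (w : JumpPath E) : Prop where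
  regular_chain : IsRegularPath (fun x => (holdingRate R x)⁻¹) w
  regular_trace : IsRegularPath (traceFactor R h) w

lemma IsTraceablePath.hTrace_chain (hR : IsRateMatrix R) {h : E → ℝ≥0} {ω : Ω}
    (hω : IsTraceablePath R h (samplePath Y e ω)) (t : ℝ≥0) :
    hTrace h (chain R Y e) t ω = pathAt (traceFactor R h) t (samplePath Y e ω) :=
  hω.regular_chain.hTrace_eq (fun x => inv_pos.2 (hR.holdingRate_pos x)) hω.regular_trace
    (fun t => chain_eq_pathAt t ω) t

variable [MeasurableSpace E] [DiscreteMeasurableSpace E] [MeasurableSpace Ω]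
  {p : E → E → ℝ} {P : E → Measure Ω}

lemma IsJumpConstruction.measurable_chain_joint (hY : IsJumpConstruction p P Y e) :
    Measurable fun q : ℝ≥0 × Ω => chain R Y e q.1 q.2 := by
  simp_rw [chain_eq_pathAt]
  exact (measurable_pathAt _).comp
    (measurable_fst.prodMk (hY.measurable_samplePath.comp measurable_snd))

variable [Countable E] [∀ η, IsProbabilityMeasure (P η)]

lemma IsJumpConstruction.ae_map_isTraceablePath (hY : IsJumpConstruction p P Y e)
    (hR : IsRateMatrix R) (hirr : IsIrreducibleOn univ P Y) (hrec : IsRecurrentOn univ P Y)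
    {h : E → ℝ≥0} (hh : (Function.support h).Nonempty) (η : E) :
    ∀ᵐ w ∂((P η).map (samplePath Y e)), IsTraceablePath R h w := by
  obtain ⟨ζ, hζ⟩ := hh
  filter_upwards [hY.ae_isRegularPath hirr hrec
    (fun x => (inv_pos.2 (hR.holdingRate_pos x)).le) (inv_pos.2 (hR.holdingRate_pos ζ)) η,
    hY.ae_isRegularPath hirr hrec (hR.traceFactor_nonneg h) (hR.traceFactor_pos_iff.2 hζ) η]
    with w h1 h2
  exact ⟨h1, h2⟩

lemma IsJumpConstruction.ae_isTraceablePath (hY : IsJumpConstruction p P Y e)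
    (hR : IsRateMatrix R) (hirr : IsIrreducibleOn univ P Y) (hrec : IsRecurrentOn univ P Y)
    {h : E → ℝ≥0} (hh : (Function.support h).Nonempty) (η : E) :
    ∀ᵐ ω ∂(P η), IsTraceablePath R h (samplePath Y e ω) :=
  ae_of_ae_map hY.measurable_samplePath.aemeasurable
    (hY.ae_map_isTraceablePath hR hirr hrec hh η)

/-- Events of the trace are computed with the canonical process. -/
lemma IsJumpConstruction.trace_event (hY : IsJumpConstruction p P Y e)
    (hR : IsRateMatrix R) (hirr : IsIrreducibleOn univ P Y) (hrec : IsRecurrentOn univ P Y)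
    {h : E → ℝ≥0} (hh : (Function.support h).Nonempty) (η : E) {B : Set (ℝ≥0 → E)}
    (hB : MeasurableSet B) :
    P η {ω | (fun t => hTrace h (chain R Y e) t ω) ∈ B} =
      (P η).map (samplePath Y e) {w | (fun t => pathAt (traceFactor R h) t w) ∈ B} := by
  rw [Measure.map_apply hY.measurable_samplePath (measurableSet_path _ hB)]
  refine measure_congr (eventuallyEq_set.2 ?_)
  filter_upwards [hY.ae_isTraceablePath hR hirr hrec hh η] with ω hω
  simp only [mem_ofPred_eq, mem_preimage, hω.hTrace_chain hR]

lemma IsJumpConstruction.trace_markov (hY : IsJumpConstruction p P Y e)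
    (hR : IsRateMatrix R) (hirr : IsIrreducibleOn univ P Y) (hrec : IsRecurrentOn univ P Y)
    {h : E → ℝ≥0} (hh : (Function.support h).Nonempty)
    {hZ : ∀ t, Measurable (hTrace h (chain R Y e) t)} (η : E) (t : ℝ≥0) (A : Set Ω)
    (hA : MeasurableSet[naturalFiltration (hTrace h (chain R Y e)) hZ t] A)
    (B : Set (ℝ≥0 → E)) (hB : MeasurableSet B) :
    P η (A ∩ {ω | (fun s => hTrace h (chain R Y e) (t + s) ω) ∈ B}) =
      ∫⁻ ω in A, (P (hTrace h (chain R Y e) t ω)).map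
        (fun ω s => hTrace h (chain R Y e) s ω) B ∂(P η) := by
  set Q := fun η => (P η).map (samplePath Y e) with hQdef
  set g := traceFactor R h with hg
  have hreg : ∀ η, ∀ᵐ w ∂(Q η), IsRegularPath g w := fun η =>
    (hY.ae_map_isTraceablePath hR hirr hrec hh η).mono fun w hw => hw.regular_trace
  have hae := hY.ae_isTraceablePath hR hirr hrec hh η
  have hpm : Measurable fun ω s => hTrace h (chain R Y e) s ω := measurable_pi_lambda _ hZ
  obtain ⟨C, hC, rfl⟩ := exists_stopped_of_measurableSet_naturalFiltration hA
  have hkernel : ∀ x, (P x).map (fun ω s => hTrace h (chain R Y e) s ω) B =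
      Q x {w | (fun s => pathAt g s w) ∈ B} := fun x => by
    rw [Measure.map_apply hpm hB]
    exact hY.trace_event hR hirr hrec hh x hB
  have hCm : MeasurableSet {w : JumpPath E | (fun s => pathAt g (min s t) w) ∈ C} :=
    measurable_stopped g t hC
  have hCΩ : MeasurableSet {ω | (fun s => hTrace h (chain R Y e) (min s t) ω) ∈ C} :=
    (naturalFiltration _ hZ).le t _ hA
  have hmarkov := hY.isJumpLaw.markov (hR.traceFactor_nonneg h) hreg η t hC hB
  have hKm : Measurable fun w => Q (pathAt g t w) {w' | (fun s => pathAt g s w') ∈ B} :=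
    (Measurable.of_discrete (f := fun x => Q x {w' | (fun s => pathAt g s w') ∈ B})).comp
      (measurable_pathAt_right g t)
  rw [← lintegral_indicator hCm, lintegral_map (hKm.indicator hCm) hY.measurable_samplePath,
    Measure.map_apply hY.measurable_samplePath (hCm.inter (measurableSet_shifted g t hB))]
    at hmarkov
  rw [← lintegral_indicator hCΩ]
  simp_rw [hkernel]
  convert hmarkov using 1
  · refine measure_congr (eventuallyEq_set.2 ?_)
    filter_upwards [hae] with ω hω
    simp only [mem_inter_iff, mem_ofPred_eq, mem_preimage, hω.hTrace_chain hR, hg]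
  · refine lintegral_congr_ae ?_
    filter_upwards [hae] with ω hω
    have hmem : ω ∈ {ω | (fun s => hTrace h (chain R Y e) (min s t) ω) ∈ C} ↔
        samplePath Y e ω ∈ {w | (fun s => pathAt g (min s t) w) ∈ C} := by
      simp only [mem_ofPred_eq, hω.hTrace_chain hR, hg]
    by_cases hω' : samplePath Y e ω ∈ {w | (fun s => pathAt g (min s t) w) ∈ C}
    · rw [indicator_of_mem hω', indicator_of_mem (hmem.2 hω'), hω.hTrace_chain hR]
    · rw [indicator_of_notMem hω', indicator_of_notMem (mt hmem.1 hω')]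

/-- The trace is a strong Markov chain on the support of `h`. -/
lemma IsJumpConstruction.isStrongMarkovChainOn (hY : IsJumpConstruction p P Y e)
    (hR : IsRateMatrix R) (hirr : IsIrreducibleOn univ P Y) (hrec : IsRecurrentOn univ P Y)
    {h : E → ℝ≥0} (hh : (Function.support h).Nonempty) :
    IsStrongMarkovChainOn (Function.support h) P (hTrace h (chain R Y e)) := by
  have hZ : ∀ t, Measurable (hTrace h (chain R Y e) t) :=
    measurable_hTrace hY.measurable_chain_joint
  have hg := hR.traceFactor_nonneg h
  have hae := hY.ae_isTraceablePath hR hirr hrec hh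
  have hrc : ∀ η, ∀ᵐ ω ∂(P η), ∀ t, ∀ᶠ s in 𝓝[>] t,
      hTrace h (chain R Y e) s ω = hTrace h (chain R Y e) t ω := fun η => by
    filter_upwards [hae η] with ω hω t
    simp_rw [hω.hTrace_chain hR]
    exact hω.regular_trace.pathAt_right_continuous hg t
  refine ⟨hZ, fun η hη => ?_, fun η _ => ?_, fun η _ => hrc η, fun η _ => ?_, ?_⟩
  · filter_upwards [hae η, ae_of_ae_map hY.measurable_samplePath.aemeasurable
      (hY.isJumpLaw.ae_start η)] with ω hω h0
    rw [hω.hTrace_chain hR, pathAt_zero_eq (n := 0) hω.regular_trace.pos _ (by simp), h0]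
    rw [h0]
    exact hR.traceFactor_pos_iff.2 hη
  · filter_upwards [hae η] with ω hω t
    rw [hω.hTrace_chain hR, ← hR.traceFactor_pos_iff]
    exact hω.regular_trace.pathAt_pos hg t
  · filter_upwards [hae η] with ω hω t
    simp_rw [hω.hTrace_chain hR]
    obtain ⟨x, hx, hx'⟩ := hω.regular_trace.pathAt_left_limit hg t
    exact ⟨x, hR.traceFactor_pos_iff.1 hx, hx'⟩
  · intro η _ τ hτ A hA B hB
    have hpm : Measurable fun ω s => hTrace h (chain R Y e) s ω := measurable_pi_lambda _ hZ
    have hpr : ∀ x, IsProbabilityMeasure ((P x).map fun ω s => hTrace h (chain R Y e) s ω) :=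
      fun x => Measure.isProbabilityMeasure_map hpm.aemeasurable
    have hjoint : Measurable fun q : ℝ≥0 × Ω =>
        pathAt (traceFactor R h) q.1 (samplePath Y e q.2) :=
      (measurable_pathAt _).comp
        (measurable_fst.prodMk (hY.measurable_samplePath.comp measurable_snd))
    have key := strong_markov_of_markov
      (K := fun x => (P x).map fun ω s => hTrace h (chain R Y e) s ω)
      (Z' := fun t ω => pathAt (traceFactor R h) t (samplePath Y e ω))
      hjoint
      ((hae η).mono fun ω hω t => hω.hTrace_chain hR t) (hrc η)
      (hY.trace_markov hR hirr hrec hh η) hτ hA hB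
    rw [key]
    refine lintegral_congr fun ω => ?_
    rw [Measure.map_apply hpm hB]
    rfl

lemma IsJumpConstruction.isIrreducibleOn_trace (hY : IsJumpConstruction p P Y e)
    (hR : IsRateMatrix R) (hirr : IsIrreducibleOn univ P Y) (hrec : IsRecurrentOn univ P Y)
    {h : E → ℝ≥0} (hh : (Function.support h).Nonempty) :
    IsIrreducibleOn (Function.support h) P (hTrace h (chain R Y e)) := by
  intro η _ ξ hξ
  by_contra! hzero
  have hall : ∀ᵐ ω ∂(P η), ∀ q : ℚ, hTrace h (chain R Y e) (q : ℝ).toNNReal ω ≠ ξ :=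
    ae_all_iff.2 fun q => by
      rw [ae_iff]
      simpa using hzero (q : ℝ).toNNReal
  have hg := hR.traceFactor_nonneg h
  obtain ⟨ω, hω, hω', hfreq⟩ := (hall.and ((hY.ae_isTraceablePath hR hirr hrec hh η).and
    (ae_of_ae_map hY.measurable_samplePath.aemeasurable
      (hY.ae_frequently hirr hrec η ξ)))).exists
  obtain ⟨n, hn⟩ := hfreq.exists
  have hlt : clock (traceFactor R h) (samplePath Y e ω) n <
      clock (traceFactor R h) (samplePath Y e ω) (n + 1) := by
    rw [clock_succ, hn]
    exact lt_add_of_pos_right _ (mul_pos (hω'.regular_trace.pos n) (hR.traceFactor_pos_iff.2 hξ))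
  obtain ⟨q, hq1, hq2⟩ := exists_rat_btwn hlt
  have hq0 : (0 : ℝ) ≤ q := (hω'.regular_trace.clock_nonneg hg n).trans hq1.le
  refine hω q ?_
  rw [hω'.hTrace_chain hR, hω'.regular_trace.pathAt_eq hg (n := n), hn]
  · rw [Real.coe_toNNReal _ hq0]; exact hq1.le
  · rwa [Real.coe_toNNReal _ hq0]

lemma IsJumpConstruction.isRecurrentOn_trace (hY : IsJumpConstruction p P Y e)
    (hR : IsRateMatrix R) (hirr : IsIrreducibleOn univ P Y) (hrec : IsRecurrentOn univ P Y)
    {h : E → ℝ≥0} (hh : (Function.support h).Nonempty) :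
    IsRecurrentOn (Function.support h) P (hTrace h (chain R Y e)) := by
  intro η hη
  have hg := hR.traceFactor_nonneg h
  filter_upwards [hY.ae_isTraceablePath hR hirr hrec hh η,
    ae_of_ae_map hY.measurable_samplePath.aemeasurable (hY.ae_frequently hirr hrec η η)]
    with ω hω hfreq
  refine frequently_atTop.2 fun T => ?_
  obtain ⟨n, hn, hT⟩ := (hfreq.and_eventually
    (hω.regular_trace.tendsto.eventually_ge_atTop (T : ℝ))).exists
  obtain ⟨t, ht⟩ : ∃ t : ℝ≥0, (t : ℝ) = clock (traceFactor R h) (samplePath Y e ω) n :=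
    ⟨_, Real.coe_toNNReal _ (hω.regular_trace.clock_nonneg hg n)⟩
  refine ⟨t, NNReal.coe_le_coe.1 (hT.trans ht.ge), ?_⟩
  rw [hω.hTrace_chain hR, hω.regular_trace.pathAt_eq hg (n := n) ht.ge, hn]
  rw [ht, clock_succ, hn]
  exact lt_add_of_pos_right _ (mul_pos (hω.regular_trace.pos n) (hR.traceFactor_pos_iff.2 hη))

lemma IsJumpConstruction.additiveFunctional_chain (hY : IsJumpConstruction p P Y e)
    (hR : IsRateMatrix R) (hirr : IsIrreducibleOn univ P Y) (hrec : IsRecurrentOn univ P Y)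
    {h : E → ℝ≥0} (hh : (Function.support h).Nonempty) (η : E) :
    ∀ᵐ ω ∂(P η), (∀ t, additiveFunctional h (chain R Y e) t ω < ∞) ∧
      Tendsto (fun t => additiveFunctional h (chain R Y e) t ω) atTop (𝓝 ∞) := by
  have hg : ∀ x, 0 ≤ (holdingRate R x)⁻¹ := fun x => (inv_pos.2 (hR.holdingRate_pos x)).le
  filter_upwards [hY.ae_isTraceablePath hR hirr hrec hh η] with ω hω
  exact ⟨hω.regular_chain.additiveFunctional_lt_top hg fun t => chain_eq_pathAt t ω,
    hω.regular_chain.tendsto_additiveFunctional hg hω.regular_trace fun t => chain_eq_pathAt t ω⟩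

end Chain

end HTrace

end

noncomputable section

namespace HTrace

variable {E Ω : Type*}

/-! ### Transition rates -/

lemma IsRegularPath.pathAt_eventually_eq_zero {g : E → ℝ} {w : JumpPath E} (hg : ∀ x, 0 ≤ g x)
    (hw : IsRegularPath g w) : ∀ᶠ s in 𝓝 (0 : ℝ≥0), pathAt g s w = pathAt g 0 w := by
  filter_upwards [(NNReal.continuous_coe.tendsto 0).eventually_lt_const
    (hw.lt_clock_jumpIndex 0)] with s hs
  exact hw.pathAt_eq hg ((clock_jumpIndex_le 0).trans (NNReal.coe_le_coe.2 zero_le)) hs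

lemma tendsto_one_sub_exp_div (c : ℝ) :
    Tendsto (fun t : ℝ≥0 => (1 - Real.exp (-(t / c))) / (t : ℝ)) (𝓝[>] 0) (𝓝 c⁻¹) := by
  have hd : HasDerivAt (fun t : ℝ => 1 - Real.exp (-(t / c))) c⁻¹ 0 := by
    have h1 : HasDerivAt (fun t : ℝ => -(t / c)) (-(1 / c)) 0 :=
      ((hasDerivAt_id (0 : ℝ)).div_const c).neg
    simpa using (h1.exp.const_sub 1)
  rw [hasDerivAt_iff_tendsto_slope_zero] at hd
  have hcoe : Tendsto (fun t : ℝ≥0 => (t : ℝ)) (𝓝[>] 0) (𝓝[≠] 0) := by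
    refine tendsto_nhdsWithin_iff.2 ⟨?_, ?_⟩
    · exact (NNReal.continuous_coe.tendsto 0).mono_left nhdsWithin_le_nhds
    · filter_upwards [self_mem_nhdsWithin] with t ht
      exact (NNReal.coe_pos.2 ht).ne'
  refine (hd.comp hcoe).congr fun t => ?_
  simp [div_eq_inv_mul]

lemma abs_integral_expMeasure_sub_le {v : ℝ → ℝ} (hv : Integrable v (expMeasure 1))
    {c δ q ε : ℝ} (hc : 0 ≤ c) (h1 : ∀ᵐ a ∂(expMeasure 1), a ≤ c → |v a - q| ≤ ε)
    (h2 : ∀ᵐ a ∂(expMeasure 1), c < a → v a = δ) :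
    |(∫ a, v a ∂(expMeasure 1) - δ) - (1 - Real.exp (-c)) * (q - δ)| ≤
      (1 - Real.exp (-c)) * ε := by
  have hI : (expMeasure 1).real (Iic c) = 1 - Real.exp (-c) := by
    rw [← compl_Ioi, probReal_compl_eq_one_sub measurableSet_Ioi, measureReal_def,
      expMeasure_Ioi hc, ENNReal.toReal_ofReal (Real.exp_pos _).le]
  have hconst : ∀ r : ℝ, ∫ a, (Iic c).indicator (fun _ => r) a ∂(expMeasure 1) =
      (1 - Real.exp (-c)) * r := fun r => by
    rw [integral_indicator_const _ measurableSet_Iic, hI, smul_eq_mul]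
  have hi : ∀ r : ℝ, Integrable ((Iic c).indicator (fun _ => r)) (expMeasure 1) := fun r =>
    (integrable_const r).indicator measurableSet_Iic
  have hvδ : Integrable (fun a => v a - δ) (expMeasure 1) := hv.sub (integrable_const δ)
  have hsub : (∫ a, v a ∂(expMeasure 1) - δ) - (1 - Real.exp (-c)) * (q - δ) =
      ∫ a, (v a - δ - (Iic c).indicator (fun _ => q - δ) a) ∂(expMeasure 1) := by
    rw [integral_sub hvδ (hi _), integral_sub hv (integrable_const δ), hconst]
    simp
  rw [hsub, ← hconst ε]
  refine abs_integral_le_integral_abs.trans (integral_mono_ae (hvδ.sub (hi _)).abs (hi ε) ?_)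
  filter_upwards [h1, h2] with a ha1 ha2
  by_cases hac : a ≤ c
  · rw [indicator_of_mem (mem_Iic.2 hac), indicator_of_mem (mem_Iic.2 hac),
      sub_sub_sub_cancel_right]
    exact ha1 hac
  · rw [indicator_of_notMem (by simpa using hac), indicator_of_notMem (by simpa using hac),
      ha2 (not_le.1 hac)]
    simp

section JumpLaw

variable [Countable E] [MeasurableSpace E]
  {p : E → E → ℝ} {Q : E → Measure (JumpPath E)} {g : E → ℝ}

lemma IsJumpLaw.real_eq_integral (hQ : IsJumpLaw p Q) (η : E) {S : Set (JumpPath E)}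
    (hS : MeasurableSet S) :
    Integrable (fun a => (stepLaw p Q η).real {w | consPath η a w ∈ S}) (expMeasure 1) ∧
      (Q η).real S = ∫ a, (stepLaw p Q η).real {w | consPath η a w ∈ S} ∂(expMeasure 1) := by
  have := hQ.isProbabilityMeasure_stepLaw η
  have hm : Measurable fun a => stepLaw p Q η {w | consPath η a w ∈ S} :=
    measurable_measure_prodMk_left (measurable_consPath η hS)
  refine ⟨Integrable.of_bound hm.ennreal_toReal.aestronglyMeasurable 1
    (ae_of_all _ fun a => ?_), ?_⟩
  · rw [Real.norm_of_nonneg measureReal_nonneg]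
    exact measureReal_le_one
  · rw [measureReal_def, hQ.apply_eq η hS, ← integral_toReal hm.aemeasurable
      (ae_of_all _ fun a => measure_lt_top _ _)]
    rfl

variable [DiscreteMeasurableSpace E]

lemma measurableSet_pathAt_eq (g : E → ℝ) (t : ℝ≥0) (ξ : E) :
    MeasurableSet {w : JumpPath E | pathAt g t w = ξ} :=
  measurable_pathAt_right g t (measurableSet_singleton ξ)

lemma IsJumpLaw.tendsto_stepLaw (hQ : IsJumpLaw p Q) (hg : ∀ x, 0 ≤ g x)
    (hreg : ∀ η, ∀ᵐ w ∂(Q η), IsRegularPath g w) (η ξ : E) :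
    Tendsto (fun s : ℝ≥0 => (stepLaw p Q η).real {w | pathAt g s w = ξ}) (𝓝 0)
      (𝓝 ((stepLaw p Q η).real {w | pathAt g 0 w = ξ})) := by
  have := hQ.isProbabilityMeasure_stepLaw η
  refine (ENNReal.tendsto_toReal (measure_ne_top _ _)).comp
    (tendsto_measure_of_ae_tendsto_indicator_of_isFiniteMeasure (𝓝 0)
      (measurableSet_pathAt_eq g 0 ξ) (fun s => measurableSet_pathAt_eq g s ξ) ?_)
  filter_upwards [ae_stepLaw (p := p) (η := η) hreg] with w hw
  filter_upwards [hw.pathAt_eventually_eq_zero hg] with s hs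
  rw [hs]

open Classical in
/-- Up to a small relative error, the process has left its initial state at a small time `t` with
probability `1 - exp (-t / g η)`, and then sits at the first state it entered. -/
lemma IsJumpLaw.abs_real_sub_le (hQ : IsJumpLaw p Q) (hg : ∀ x, 0 ≤ g x)
    (hreg : ∀ η, ∀ᵐ w ∂(Q η), IsRegularPath g w) {η : E} (hη : 0 < g η) (ξ : E) {t : ℝ≥0}
    {ε : ℝ} (hε : ∀ s ≤ t, |(stepLaw p Q η).real {w | pathAt g s w = ξ} -
      (stepLaw p Q η).real {w | pathAt g 0 w = ξ}| ≤ ε) :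
    |((Q η).real {w | pathAt g t w = ξ} - if η = ξ then 1 else 0) -
      (1 - Real.exp (-(t / g η))) *
        ((stepLaw p Q η).real {w | pathAt g 0 w = ξ} - if η = ξ then 1 else 0)| ≤
      (1 - Real.exp (-(t / g η))) * ε := by
  have := hQ.isProbabilityMeasure_stepLaw η
  obtain ⟨hint, heq⟩ := hQ.real_eq_integral η (measurableSet_pathAt_eq g t ξ)
  rw [heq]
  refine abs_integral_expMeasure_sub_le hint (div_nonneg t.coe_nonneg hη.le) ?_
    (ae_of_all _ fun a hac => ?_)
  · filter_upwards [ae_expMeasure_pos] with a ha hac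
    obtain ⟨b, hb⟩ : ∃ b : ℝ≥0, (b : ℝ) = a * g η :=
      ⟨_, Real.coe_toNNReal _ (mul_nonneg ha.le (hg η))⟩
    have hbt : b ≤ t := by
      rw [← NNReal.coe_le_coe, hb]
      exact (le_div_iff₀ hη).1 hac
    refine le_of_eq_of_le ?_ (hε (t - b) tsub_le_self)
    congr 2
    refine measureReal_congr (eventuallyEq_set.2 ?_)
    filter_upwards [ae_stepLaw (p := p) (η := η) hreg] with w hw
    rw [hw.pathAt_consPath hb hbt]
  · have hlt : (t : ℝ) < a * g η := (div_lt_iff₀ hη).1 hac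
    simp only [mem_ofPred_eq, pathAt_consPath_of_lt hlt]
    split_ifs with hηξ
    · subst hηξ
      simp
    · simp [hηξ]

open Classical in
lemma IsJumpLaw.tendsto_rate (hQ : IsJumpLaw p Q) (hg : ∀ x, 0 ≤ g x)
    (hreg : ∀ η, ∀ᵐ w ∂(Q η), IsRegularPath g w) {η : E} (hη : 0 < g η) (ξ : E) :
    Tendsto (fun t : ℝ≥0 => ((Q η).real {w | pathAt g t w = ξ} - if η = ξ then 1 else 0) / (t : ℝ))
      (𝓝[>] 0) (𝓝 ((g η)⁻¹ *
        ((stepLaw p Q η).real {w | pathAt g 0 w = ξ} - if η = ξ then 1 else 0))) := by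
  set δ : ℝ := if η = ξ then 1 else 0 with hδ
  set q : ℝ := (stepLaw p Q η).real {w | pathAt g 0 w = ξ} with hq
  have hpos : ∀ t : ℝ≥0, 0 < t → 0 < 1 - Real.exp (-(t / g η)) := fun t ht => by
    have : 0 < (t : ℝ) / g η := div_pos (NNReal.coe_pos.2 ht) hη
    have := Real.exp_lt_one_iff.2 (neg_lt_zero.2 this)
    linarith
  have h1 : Tendsto (fun t : ℝ≥0 => ((Q η).real {w | pathAt g t w = ξ} - δ) /
      (1 - Real.exp (-(t / g η)))) (𝓝[>] 0) (𝓝 (q - δ)) := by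
    rw [Metric.tendsto_nhds]
    intro ε hε
    have hcont := Metric.tendsto_nhds.1 (hQ.tendsto_stepLaw hg hreg η ξ) (ε / 2) (half_pos hε)
    obtain ⟨r, hr, hball⟩ := Metric.eventually_nhds_iff.1 hcont
    have hsmall : ∀ᶠ t : ℝ≥0 in 𝓝[>] 0, dist t 0 < r :=
      nhdsWithin_le_nhds (Metric.ball_mem_nhds 0 hr)
    filter_upwards [hsmall, self_mem_nhdsWithin] with t ht ht0
    have hle := hQ.abs_real_sub_le hg hreg hη ξ (t := t) (ε := ε / 2) fun s hs => by
      refine (hball ?_).le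
      rw [NNReal.dist_eq] at ht ⊢
      simp only [NNReal.coe_zero, sub_zero, NNReal.abs_eq] at ht ⊢
      exact (NNReal.coe_le_coe.2 hs).trans_lt ht
    have hp := hpos t ht0
    rw [Real.dist_eq, div_sub' hp.ne', abs_div, abs_of_pos hp, div_lt_iff₀ hp]
    refine hle.trans_lt ?_
    rw [mul_comm]
    exact mul_lt_mul_of_pos_right (half_lt_self hε) hp
  refine ((tendsto_one_sub_exp_div (g η)).mul h1).congr' ?_
  filter_upwards [self_mem_nhdsWithin] with t ht
  have hp := (hpos t ht).ne'
  have ht' : (t : ℝ) ≠ 0 := (NNReal.coe_pos.2 ht).ne'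
  field_simp

end JumpLaw

/-! ### Identification of the rates -/

section Identification

variable {R : E → E → ℝ} {h : E → ℝ≥0} {w : JumpPath E}

lemma IsTraceablePath.hitTime_eq_iff (hR : IsRateMatrix R) (hw : IsTraceablePath R h w) {ξ : E}
    (hξ : ξ ∈ Function.support h) :
    hitTime (Function.support h) (fun t => pathAt (fun x => (holdingRate R x)⁻¹) t w) =
        hitTime {ξ} (fun t => pathAt (fun x => (holdingRate R x)⁻¹) t w) ↔
      pathAt (traceFactor R h) 0 w = ξ := by
  classical
  have hex : ∃ n, w.1 n ∈ Function.support h :=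
    ⟨_, hR.traceFactor_pos_iff.1 (hw.regular_trace.pathAt_pos (hR.traceFactor_nonneg h) 0)⟩
  have hn := Nat.find_spec hex
  have hlt : ∀ k < Nat.find hex, w.1 k ∉ Function.support h := fun k hk => Nat.find_min hex hk
  rw [hw.regular_chain.hitTime_eq_hitTime_iff (fun x => inv_pos.2 (hR.holdingRate_pos x)) hn hlt hξ,
    pathAt_zero_eq hw.regular_trace.pos (hR.traceFactor_pos_iff.2 hn) fun k hk => ?_]
  exact le_antisymm (not_lt.1 fun hpos => hlt k hk (hR.traceFactor_pos_iff.1 hpos))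
    (hR.traceFactor_nonneg h _)

lemma IsTraceablePath.tail (hw : IsTraceablePath R h w) : IsTraceablePath R h (tailPath w) :=
  ⟨hw.regular_chain.tail, hw.regular_trace.tail⟩

lemma IsTraceablePath.returnTime_eq_iff (hR : IsRateMatrix R) (hw : IsTraceablePath R h w)
    (h01 : w.1 1 ≠ w.1 0) {ξ : E} (hξ : ξ ∈ Function.support h) :
    returnTime (Function.support h) (fun t => pathAt (fun x => (holdingRate R x)⁻¹) t w) =
        returnTime {ξ} (fun t => pathAt (fun x => (holdingRate R x)⁻¹) t w) ↔
      pathAt (traceFactor R h) 0 (tailPath w) = ξ := by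
  have hpos : ∀ x, 0 < (holdingRate R x)⁻¹ := fun x => inv_pos.2 (hR.holdingRate_pos x)
  rw [hw.regular_chain.returnTime_eq hpos h01, hw.regular_chain.returnTime_eq hpos h01,
    ENNReal.add_right_inj ENNReal.ofReal_ne_top]
  exact hw.tail.hitTime_eq_iff hR hξ

lemma jumpProb_self (R : E → E → ℝ) (η : E) : jumpProb R η η = 0 := by simp [jumpProb]

lemma hasSum_measureReal_singleton [Countable E] [MeasurableSpace E] [DiscreteMeasurableSpace E]
    (μ : Measure E) [IsFiniteMeasure μ] (s : Set E) :
    HasSum (fun ζ : s => μ.real {(ζ : E)}) (μ.real s) := by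
  have h1 : ∑' ζ : s, μ {(ζ : E)} = μ s := by
    rw [tsum_subtype s fun ζ => μ {ζ}, μ.tsum_indicator_apply_singleton s (MeasurableSet.of_discrete)]
  have h2 := ENNReal.hasSum_toReal (f := fun ζ : s => μ {(ζ : E)})
    (by rw [h1]; exact measure_ne_top _ _)
  rwa [← ENNReal.tsum_toReal_eq (fun _ => measure_ne_top _ _), h1] at h2

variable [Countable E] [MeasurableSpace E] [DiscreteMeasurableSpace E] [MeasurableSpace Ω]
  {P : E → Measure Ω} [∀ η, IsProbabilityMeasure (P η)] {Y : ℕ → Ω → E} {e : ℕ → Ω → ℝ}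

lemma IsJumpConstruction.real_returnTime_eq (hY : IsJumpConstruction (jumpProb R) P Y e)
    (hR : IsRateMatrix R) (hirr : IsIrreducibleOn univ P Y) (hrec : IsRecurrentOn univ P Y)
    (η : E) {ξ : E} (hξ : ξ ∈ Function.support h) :
    (P η).real {ω | returnTime (Function.support h) (fun t => chain R Y e t ω) =
        returnTime {ξ} (fun t => chain R Y e t ω)} =
      (stepLaw (jumpProb R) (fun η => (P η).map (samplePath Y e)) η).real
        {w | pathAt (traceFactor R h) 0 w = ξ} := by
  have hm := measurableSet_pathAt_eq (traceFactor R h) 0 ξ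
  rw [← hY.isJumpLaw.map_tailPath η, map_measureReal_apply measurable_tailPath hm,
    map_measureReal_apply hY.measurable_samplePath (measurable_tailPath hm)]
  refine measureReal_congr (eventuallyEq_set.2 ?_)
  filter_upwards [hY.ae_isTraceablePath hR hirr hrec ⟨ξ, hξ⟩ η,
    ae_of_ae_map hY.measurable_samplePath.aemeasurable
      (hY.isJumpLaw.ae_first_jump (jumpProb_self R η))] with ω hω h01
  simp only [mem_ofPred_eq, mem_preimage, chain_eq_pathAt]
  exact hω.returnTime_eq_iff hR h01 hξ

lemma IsJumpConstruction.real_hitTime_eq (hY : IsJumpConstruction (jumpProb R) P Y e)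
    (hR : IsRateMatrix R) (hirr : IsIrreducibleOn univ P Y) (hrec : IsRecurrentOn univ P Y)
    (η : E) {ξ : E} (hξ : ξ ∈ Function.support h) :
    (P η).real {ω | hitTime (Function.support h) (fun t => chain R Y e t ω) =
        hitTime {ξ} (fun t => chain R Y e t ω)} =
      ((P η).map (samplePath Y e)).real {w | pathAt (traceFactor R h) 0 w = ξ} := by
  rw [map_measureReal_apply hY.measurable_samplePath (measurableSet_pathAt_eq _ 0 ξ)]
  refine measureReal_congr (eventuallyEq_set.2 ?_)
  filter_upwards [hY.ae_isTraceablePath hR hirr hrec ⟨ξ, hξ⟩ η] with ω hω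
  simp only [mem_ofPred_eq, mem_preimage, chain_eq_pathAt]
  exact hω.hitTime_eq_iff hR hξ

/-- The entrance law into the support of `h` after the first jump has total mass one. -/
lemma IsJumpConstruction.hasSum_traceRate (hY : IsJumpConstruction (jumpProb R) P Y e)
    (hR : IsRateMatrix R) (hirr : IsIrreducibleOn univ P Y) (hrec : IsRecurrentOn univ P Y)
    {η : E} (hη : η ∈ Function.support h) :
    HasSum (fun ζ : ↥(Function.support h \ {η}) => traceRate R P (chain R Y e) h η ζ)
      (holdingRate R η / h η * (1 -
        (stepLaw (jumpProb R) (fun η => (P η).map (samplePath Y e)) η).real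
          {w | pathAt (traceFactor R h) 0 w = η})) := by
  have hQ := hY.isJumpLaw
  have hpr := hQ.isProbabilityMeasure_stepLaw η
  set κ := stepLaw (jumpProb R) (fun η => (P η).map (samplePath Y e)) η with hκ
  set g := traceFactor R h with hg
  have hm : Measurable (pathAt (E := E) g 0) := measurable_pathAt_right g 0
  have hprm : IsProbabilityMeasure (κ.map (pathAt g 0)) :=
    Measure.isProbabilityMeasure_map hm.aemeasurable
  have hreal : ∀ ζ, (κ.map (pathAt g 0)).real {ζ} = κ.real {w | pathAt g 0 w = ζ} := fun ζ => by
    rw [map_measureReal_apply hm (measurableSet_singleton ζ)]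
    rfl
  have hF : (κ.map (pathAt g 0)).real (Function.support h) = 1 := by
    have : ∀ᵐ x ∂(κ.map (pathAt g 0)), x ∈ Function.support h := by
      rw [ae_map_iff hm.aemeasurable MeasurableSet.of_discrete]
      filter_upwards [ae_stepLaw (p := jumpProb R) (η := η)
        (hY.ae_map_isTraceablePath hR hirr hrec ⟨η, hη⟩)] with w hw
      exact hR.traceFactor_pos_iff.1 (hw.regular_trace.pathAt_pos (hR.traceFactor_nonneg h) 0)
    rw [measureReal_def, (mem_ae_iff_prob_eq_one
      (s := Function.support h) MeasurableSet.of_discrete).1 this,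
      ENNReal.toReal_one]
  have hsum := hasSum_measureReal_singleton (κ.map (pathAt g 0)) (Function.support h \ {η})
  rw [measureReal_sdiff (by simpa using hη) (measurableSet_singleton η), hF, hreal] at hsum
  have hfun : (fun ζ : ↥(Function.support h \ {η}) => traceRate R P (chain R Y e) h η ζ) =
      fun ζ : ↥(Function.support h \ {η}) =>
        holdingRate R η / h η * (κ.map (pathAt g 0)).real {(ζ : E)} := funext fun ζ => by
    rw [traceRate, hreal, hY.real_returnTime_eq hR hirr hrec η ζ.2.1]
  rw [hfun]
  exact hsum.mul_left (holdingRate R η / h η)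

lemma IsJumpConstruction.hasTransitionRates (hY : IsJumpConstruction (jumpProb R) P Y e)
    (hR : IsRateMatrix R) (hirr : IsIrreducibleOn univ P Y) (hrec : IsRecurrentOn univ P Y)
    (hh : (Function.support h).Nonempty) :
    HasTransitionRates (Function.support h) P (hTrace h (chain R Y e))
      (traceRateMatrix R P (chain R Y e) h) := by
  classical
  intro η hη ξ hξ
  have hreg : ∀ η, ∀ᵐ w ∂((P η).map (samplePath Y e)), IsRegularPath (traceFactor R h) w :=
    fun η => (hY.ae_map_isTraceablePath hR hirr hrec hh η).mono fun w hw => hw.regular_trace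
  have hlim := hY.isJumpLaw.tendsto_rate (hR.traceFactor_nonneg h) hreg
    (hR.traceFactor_pos_iff.2 hη) ξ
  have hreal : ∀ t, (P η).real {ω | hTrace h (chain R Y e) t ω = ξ} =
      ((P η).map (samplePath Y e)).real {w | pathAt (traceFactor R h) t w = ξ} := fun t => by
    rw [map_measureReal_apply hY.measurable_samplePath (measurableSet_pathAt_eq _ t ξ)]
    refine measureReal_congr (eventuallyEq_set.2 ?_)
    filter_upwards [hY.ae_isTraceablePath hR hirr hrec hh η] with ω hω
    simp only [mem_ofPred_eq, mem_preimage, hω.hTrace_chain hR]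
  have hrate : (traceFactor R h η)⁻¹ = holdingRate R η / h η := by
    rw [traceFactor, mul_inv, inv_inv, div_eq_inv_mul]
  rw [hrate] at hlim
  have hval : traceRateMatrix R P (chain R Y e) h η ξ = holdingRate R η / h η *
      ((stepLaw (jumpProb R) (fun η => (P η).map (samplePath Y e)) η).real
        {w | pathAt (traceFactor R h) 0 w = ξ} - if η = ξ then 1 else 0) := by
    unfold traceRateMatrix
    split_ifs with hηξ
    · rw [(hY.hasSum_traceRate hR hirr hrec hη).tsum_eq, ← hηξ]
      ring
    · rw [traceRate, hY.real_returnTime_eq hR hirr hrec η hξ, sub_zero]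
  rw [hval]
  simp_rw [hreal]
  convert hlim

end Identification

end HTrace

end

noncomputable section

namespace HTrace

variable {E Ω : Type*} {R : E → E → ℝ}

lemma IsRateMatrix.jumpProb_nonneg (hR : IsRateMatrix R) (η ξ : E) : 0 ≤ jumpProb R η ξ := by
  unfold jumpProb
  split_ifs with h
  · exact le_rfl
  · exact div_nonneg (hR.nonneg η ξ h) (hR.holdingRate_pos η).le

lemma IsRateMatrix.holdingRate_mul_jumpProb (hR : IsRateMatrix R) {η ξ : E} (h : η ≠ ξ) :
    holdingRate R η * jumpProb R η ξ = R η ξ := by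
  rw [jumpProb, if_neg h, mul_div_cancel₀ _ (hR.holdingRate_pos η).ne']

variable [Countable E] [MeasurableSpace E]

/-- Decomposition of the entrance law at the first jump. -/
lemma IsJumpLaw.hasSum_real_stepLaw {p : E → E → ℝ} {Q : E → Measure (JumpPath E)}
    (hQ : IsJumpLaw p Q) (hp : ∀ η ξ, 0 ≤ p η ξ) (η : E) {S : Set (JumpPath E)}
    (hS : MeasurableSet S) :
    HasSum (fun ζ => p η ζ * (Q ζ).real S) ((stepLaw p Q η).real S) := by
  have := hQ.prob
  have := hQ.isProbabilityMeasure_stepLaw η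
  have h1 : ∑' ζ, ENNReal.ofReal (p η ζ) * Q ζ S = stepLaw p Q η S := by
    rw [stepLaw, Measure.sum_apply _ hS]
    rfl
  have h2 := ENNReal.hasSum_toReal (f := fun ζ => ENNReal.ofReal (p η ζ) * Q ζ S)
    (by rw [h1]; exact measure_ne_top _ _)
  rw [← ENNReal.tsum_toReal_eq
    (fun _ => ENNReal.mul_ne_top ENNReal.ofReal_ne_top (measure_ne_top _ _)), h1] at h2
  simpa only [measureReal_def, ENNReal.toReal_mul, ENNReal.toReal_ofReal (hp _ _)] using h2

variable [DiscreteMeasurableSpace E] [MeasurableSpace Ω] {P : E → Measure Ω}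
  [∀ η, IsProbabilityMeasure (P η)] {Y : ℕ → Ω → E} {e : ℕ → Ω → ℝ}

/-- First-step decomposition of the off-diagonal rates of the trace. -/
lemma IsJumpConstruction.hasSum_stepLaw_trace (hY : IsJumpConstruction (jumpProb R) P Y e)
    (hR : IsRateMatrix R) (hirr : IsIrreducibleOn univ P Y) (hrec : IsRecurrentOn univ P Y)
    {h : E → ℝ≥0} {η ξ : E} (hη : η ∈ Function.support h) (hξ : ξ ∈ Function.support h)
    (hne : η ≠ ξ) :
    HasSum (fun ζ : ↥(Function.support h)ᶜ => R η ζ * (P ζ).real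
        {ω | hitTime (Function.support h) (fun t => chain R Y e t ω) =
          hitTime {ξ} (fun t => chain R Y e t ω)})
      (holdingRate R η * (stepLaw (jumpProb R) (fun η => (P η).map (samplePath Y e)) η).real
        {w | pathAt (traceFactor R h) 0 w = ξ} - R η ξ) := by
  classical
  have hQ := hY.isJumpLaw
  have hpr := hQ.prob
  have hsum := (hQ.hasSum_real_stepLaw hR.jumpProb_nonneg η
    (measurableSet_pathAt_eq (traceFactor R h) 0 ξ)).mul_left (holdingRate R η)
  have hstart : ∀ ζ ∈ Function.support h, ((P ζ).map (samplePath Y e)).real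
      {w | pathAt (traceFactor R h) 0 w = ξ} = if ζ = ξ then 1 else 0 := fun ζ hζ => by
    have hae : ∀ᵐ w ∂((P ζ).map (samplePath Y e)), pathAt (traceFactor R h) 0 w = ζ := by
      filter_upwards [hY.ae_map_isTraceablePath hR hirr hrec ⟨ξ, hξ⟩ ζ, hQ.ae_start ζ] with w hw h0
      rw [pathAt_zero_eq (n := 0) hw.regular_trace.pos _ (by simp), h0]
      rw [h0]
      exact hR.traceFactor_pos_iff.2 hζ
    split_ifs with hζξ
    · rw [← probReal_univ (μ := (P ζ).map (samplePath Y e))]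
      refine measureReal_congr (eventuallyEq_set.2 ?_)
      filter_upwards [hae] with w hw
      simp [hw, hζξ]
    · rw [← measureReal_empty (μ := (P ζ).map (samplePath Y e))]
      refine measureReal_congr (eventuallyEq_set.2 ?_)
      filter_upwards [hae] with w hw
      simp [hw, hζξ]
  have hsub := hsum.sub (hasSum_ite_eq ξ (R η ξ))
  change HasSum ((fun ζ => R η ζ * (P ζ).real
        {ω | hitTime (Function.support h) (fun t => chain R Y e t ω) =
          hitTime {ξ} (fun t => chain R Y e t ω)}) ∘ ((↑) : ↥(Function.support h)ᶜ → E)) _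
  rw [hasSum_subtype_iff_indicator]
  have hfun : ((Function.support h)ᶜ.indicator fun ζ => R η ζ * (P ζ).real
        {ω | hitTime (Function.support h) (fun t => chain R Y e t ω) =
          hitTime {ξ} (fun t => chain R Y e t ω)}) =
      fun ζ => holdingRate R η * (jumpProb R η ζ * ((P ζ).map (samplePath Y e)).real
        {w | pathAt (traceFactor R h) 0 w = ξ}) - if ζ = ξ then R η ξ else 0 := by
    funext ζ
    by_cases hζ : ζ ∈ Function.support h
    · rw [indicator_of_notMem (by simpa using hζ), hstart ζ hζ]
      split_ifs with hζξ
      · rw [hζξ, mul_one, hR.holdingRate_mul_jumpProb hne, sub_self]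
      · simp
    · have hζξ : ζ ≠ ξ := fun h => hζ (h ▸ hξ)
      have hηζ : η ≠ ζ := fun h => hζ (h ▸ hη)
      rw [indicator_of_mem (by simpa using hζ), hY.real_hitTime_eq hR hirr hrec ζ hξ, if_neg hζξ,
        sub_zero, ← mul_assoc, hR.holdingRate_mul_jumpProb hηζ]
  rw [hfun]
  exact hsub

end HTrace

end

theorem proposition6p1 {E Ω : Type*} [Countable E] [MeasurableSpace E]
    [DiscreteMeasurableSpace E] [MeasurableSpace Ω]
    (R : E → E → ℝ) (hR : HTrace.IsRateMatrix R)
    (P : E → Measure Ω) [∀ η, IsProbabilityMeasure (P η)]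
    (Y : ℕ → Ω → E) (e : ℕ → Ω → ℝ)
    (hY : HTrace.IsJumpConstruction (HTrace.jumpProb R) P Y e)
    (hirr : HTrace.IsIrreducibleOn Set.univ P Y)
    (hrec : HTrace.IsRecurrentOn Set.univ P Y) :
    (∀ h : E → ℝ≥0, (Function.support h).Nonempty →
      -- the trace is almost surely well defined
      (∀ η ∈ Function.support h, ∀ᵐ ω ∂(P η),
        (∀ t, HTrace.additiveFunctional h (HTrace.chain R Y e) t ω < ∞) ∧
        Tendsto (fun t => HTrace.additiveFunctional h (HTrace.chain R Y e) t ω) atTop (𝓝 ∞)) ∧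
      HTrace.IsStrongMarkovChainOn (Function.support h) P
        (HTrace.hTrace h (HTrace.chain R Y e)) ∧
      HTrace.IsIrreducibleOn (Function.support h) P (HTrace.hTrace h (HTrace.chain R Y e)) ∧
      HTrace.IsRecurrentOn (Function.support h) P (HTrace.hTrace h (HTrace.chain R Y e)) ∧
      (∀ η ∈ Function.support h,
        Summable fun ζ : ↥(Function.support h \ {η}) =>
          HTrace.traceRate R P (HTrace.chain R Y e) h η ζ) ∧
      HTrace.HasTransitionRates (Function.support h) P (HTrace.hTrace h (HTrace.chain R Y e))
        (HTrace.traceRateMatrix R P (HTrace.chain R Y e) h)) ∧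
    (∀ F : Set E, F.Nonempty → ∀ RF : E → E → ℝ,
      HTrace.HasTransitionRates F P
        (HTrace.hTrace (F.indicator fun _ => 1) (HTrace.chain R Y e)) RF →
      ∀ η ∈ F, ∀ ξ ∈ F, η ≠ ξ →
        (Summable fun ζ : ↥Fᶜ => R η ζ * (P ζ).real
          {ω | HTrace.hitTime F (fun t => HTrace.chain R Y e t ω) =
            HTrace.hitTime {ξ} (fun t => HTrace.chain R Y e t ω)}) ∧
        RF η ξ = R η ξ + ∑' ζ : ↥Fᶜ, R η ζ * (P ζ).real
          {ω | HTrace.hitTime F (fun t => HTrace.chain R Y e t ω) =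
            HTrace.hitTime {ξ} (fun t => HTrace.chain R Y e t ω)}) := by
  refine ⟨fun h hh => ⟨fun η _ => hY.additiveFunctional_chain hR hirr hrec hh η,
    hY.isStrongMarkovChainOn hR hirr hrec hh, hY.isIrreducibleOn_trace hR hirr hrec hh,
    hY.isRecurrentOn_trace hR hirr hrec hh,
    fun η hη => (hY.hasSum_traceRate hR hirr hrec hη).summable,
    hY.hasTransitionRates hR hirr hrec hh⟩, ?_⟩
  intro F hF RF hRF η hη ξ hξ hne
  have hsupp : Function.support (F.indicator fun _ => (1 : ℝ≥0)) = F := by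
    ext x
    by_cases hx : x ∈ F <;> simp [hx]
  have hηs : η ∈ Function.support (F.indicator fun _ => (1 : ℝ≥0)) := by rwa [hsupp]
  have hξs : ξ ∈ Function.support (F.indicator fun _ => (1 : ℝ≥0)) := by rwa [hsupp]
  have hsum := hY.hasSum_stepLaw_trace hR hirr hrec hηs hξs hne
  have hrates := hY.hasTransitionRates hR hirr hrec
    (h := F.indicator fun _ => (1 : ℝ≥0)) ⟨η, hηs⟩
  have hRF' := tendsto_nhds_unique (hRF η hη ξ hξ) (hrates η hηs ξ hξs)
  rw [HTrace.traceRateMatrix, if_neg hne, HTrace.traceRate,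
    hY.real_returnTime_eq hR hirr hrec η hξs, Set.indicator_of_mem hη, NNReal.coe_one,
    div_one] at hRF'
  rw [hsupp] at hsum
  refine ⟨hsum.summable, ?_⟩
  rw [hsum.tsum_eq, hRF']
  ring
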